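/- Let $\Omega\subset\mathbb R^3$ be a bounded domain (nonempty, open, connected) with boundary of class $C^1$ (in particular, any bounded smooth domain), strictly starshaped about the origin: $\Omega$ is starshaped about $0$ and there is $c>0$ with $x\cdot\nu(x)>c$ for all $x\in\partial\Omega$, where $\nu$ is the outward unit normal. Let $p>1$, $0<q\le 3$, and let $g(s)=|s|^{p-1}s$ for $|s|<1$, $g(s)=|s|^{q-1}s$ for $|s|\ge 1$. For $\lambda\in\mathbb R$ consider the problem $$-\Delta u=\lambda g(u)+|u|^{4}u \ \text{ in }\Omega,\qquad u>0\ \text{ in }\Omega,\qquad u=0\ \text{ on }\partial\Omega,\tag{1}$$ with solutions $u\in C^2(\Omega)\cap C(\overline\Omega)$. Then there is a constant $\lambda_0=\lambda_0(q,p,\Omega)>0$ such that whenever (1) has a solution with parameter $\lambda$, the following hold. 1. If $\lambda\ge 0$ or $p\le 5$, then $\lambda\ge\lambda_0$. 2. In all cases, $|\lambda|\ge\lambda_0$. In particular, positive solutions do not bifurcate from infinity at $\lambda=0$: there is no sequence of solutions $(\lambda_n,u_n)$ of (1) with $\lambda_n\to0$ and $\sup_\Omega u_n\to\infty$. -/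

import Mathlib

open Set Filter Topology

noncomputable section

/-- Euclidean three-space. -/
abbrev E3 : Type := EuclideanSpace ℝ (Fin 3)

/-- `ν` is the outward unit normal of `Ω` at the boundary point `x`: near `x` the set `Ω` is the
sublevel set `{ρ < 0}` of a `C¹` function `ρ` with non-vanishing gradient, and
`ν = ∇ρ(x) / |∇ρ(x)|`. -/
def IsOutwardUnitNormal (Ω : Set E3) (x ν : E3) : Prop :=
  ∃ ρ : E3 → ℝ, ContDiffAt ℝ 1 ρ x ∧ gradient ρ x ≠ 0 ∧
    (∀ᶠ y in 𝓝 x, y ∈ Ω ↔ ρ y < 0) ∧ ν = ‖gradient ρ x‖⁻¹ • gradient ρ x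

/-- `Ω` is a bounded domain (a nonempty, connected, bounded open set) of `ℝ³` with boundary of
class `C¹`. -/
structure IsBoundedC1Domain (Ω : Set E3) : Prop where
  isOpen : IsOpen Ω
  isConnected : IsConnected Ω
  isBounded : Bornology.IsBounded Ω
  exists_normal : ∀ x ∈ frontier Ω, ∃ ν : E3, IsOutwardUnitNormal Ω x ν

/-- `Ω` is strictly starshaped about the origin: it is starshaped about the origin and
`x · ν > c` on the boundary for some constant `c > 0`, where `ν` is the outward unit normal. -/
def IsStrictlyStarshaped (Ω : Set E3) : Prop :=
  StarConvex ℝ 0 Ω ∧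
    ∃ c : ℝ, 0 < c ∧ ∀ x ∈ frontier Ω, ∀ ν : E3, IsOutwardUnitNormal Ω x ν → c < inner ℝ x ν

/-- The subcritical term: `|s|^(p-1) s` for `|s| < 1` and `|s|^(q-1) s` for `|s| ≥ 1`. -/
def subcriticalTerm (p q : ℝ) (s : ℝ) : ℝ :=
  if |s| < 1 then |s| ^ (p - 1) * s else |s| ^ (q - 1) * s

/-- `u` is a (classical) solution of `-Δu = lam g(u) + |u|⁴ u` in `Ω`, `u > 0` in `Ω`,
`u = 0` on `∂Ω`, where `g = subcriticalTerm p q`. -/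
structure IsPositiveSolution (Ω : Set E3) (p q lam : ℝ) (u : E3 → ℝ) : Prop where
  contDiffOn : ContDiffOn ℝ 2 u Ω
  continuousOn : ContinuousOn u (closure Ω)
  equation : ∀ x ∈ Ω, -(Laplacian.laplacian u x) =
    lam * subcriticalTerm p q (u x) + |u x| ^ 4 * u x
  pos : ∀ x ∈ Ω, 0 < u x
  boundary : ∀ x ∈ frontier Ω, u x = 0

/-- Positive solutions bifurcate from infinity at `lam = 0`: there are solutions `(lamₙ, uₙ)` with
`lamₙ → 0` and `sup_Ω uₙ → ∞`. -/
def BifurcatesFromInfinityAtZero (Ω : Set E3) (p q : ℝ) : Prop :=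
  ∃ (lam : ℕ → ℝ) (u : ℕ → E3 → ℝ), (∀ n, IsPositiveSolution Ω p q (lam n) (u n)) ∧
    Tendsto lam atTop (𝓝 0) ∧ Tendsto (fun n => sSup (u n '' Ω)) atTop atTop

end

open MeasureTheory
open scoped Laplacian

/-! Extend `u` by zero to `v`, so that `-Δv = h` in `Ω` with `h = lam g(v) + v⁵`, and let `M = ∫ h`
be the total flux through the boundary. Two estimates, both quadratic in `M`, force `|lam|` to be
bounded below.

Pohozaev's identity bounds the boundary integral of `(x·ν)|∂_ν v|²` by a multiple of `lam ∫ H(v)`,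
where `H(s) = 6G(s) - s g(s)` and `G` is the primitive of `g`; the critical power cancels. Strict
starshapedness and Cauchy–Schwarz bound the boundary integral below by `κ M²`. As `v` is only
continuous up to the boundary, no normal derivative is available. Instead `v` is compared with its
dilation `v(μ x)` as `μ ↓ 1`: the energy of `v` in the layer `Ω \ μ⁻¹Ω` replaces the boundary term,
and testing the equation with a cutoff bounds that energy below by the flux (`energy_layer_le`,
`flux_sq_le`, `pohozaev`).

Conversely `|H(s)| ≤ 4(s² + s⁴)` because `q ≤ 3`, and `∫ (v² + v⁴) ≤ C M²` whenever `v⁵ ≤ 2h`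
(`exists_integral_sq_add_pow_four_le`). The square is controlled by estimates for the Laplacian with
`L¹` data. For the fourth power these suffice where `v ≲ 1/M`, while `v⁴ ≤ M v⁵ ≤ 2M h` where `v ≥
1/M`. Hence `κ M² ≤ 4C |lam| M²` with `M > 0`.

The condition `v⁵ ≤ 2h` is clear for `lam ≥ 0`. If `lam < 0` and `p ≤ 5`, then `H ≥ 0` and Pohozaev
excludes solutions (`parameter_nonneg`). If `p ≥ 5`, then `g(s) ≤ s⁵`, and `|lam| < 1/2` is enough.
-/

/-! ### Solutions extended by zero and their weak form -/

/-- `v` is continuous on the whole space, vanishes off `Ω`, is positive and `C²` in `Ω`, and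
solves `-Δv = h` there, where `h` is continuous and vanishes off `Ω`. -/
structure IsDirichletSolution (Ω : Set E3) (h v : E3 → ℝ) : Prop where
  isOpen : IsOpen Ω
  isBounded : Bornology.IsBounded Ω
  contDiffOn : ContDiffOn ℝ 2 v Ω
  continuous : Continuous v
  equation : ∀ x ∈ Ω, -(Laplacian.laplacian v x) = h x
  pos : ∀ x ∈ Ω, 0 < v x
  eq_zero : ∀ x ∉ Ω, v x = 0
  continuous_rhs : Continuous h
  rhs_eq_zero : ∀ x ∉ Ω, h x = 0

lemma gradient_def' (w : E3 → ℝ) :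
    gradient w = fun x => (InnerProductSpace.toDual ℝ E3).symm (fderiv ℝ w x) := rfl

lemma norm_gradient (w : E3 → ℝ) (x : E3) : ‖gradient w x‖ = ‖fderiv ℝ w x‖ := by
  simp [gradient]

lemma ContDiff.continuous_gradient {w : E3 → ℝ} (hw : ContDiff ℝ 1 w) :
    Continuous (gradient w) := by
  rw [gradient_def']
  exact (InnerProductSpace.toDual ℝ E3).symm.continuous.comp (hw.continuous_fderiv one_ne_zero)

lemma ContDiffOn.continuousOn_gradient {w : E3 → ℝ} {Ω : Set E3} (hΩ : IsOpen Ω)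
    (hw : ContDiffOn ℝ 2 w Ω) : ContinuousOn (gradient w) Ω := by
  rw [gradient_def']
  exact (InnerProductSpace.toDual ℝ E3).symm.continuous.comp_continuousOn
    (hw.continuousOn_fderiv_of_isOpen hΩ (by norm_num))

lemma gradient_eq_zero_of_notMem_tsupport {w : E3 → ℝ} {x : E3} (hx : x ∉ tsupport w) :
    gradient w x = 0 := by
  have : w =ᶠ[𝓝 x] fun _ => (0 : ℝ) := notMem_tsupport_iff_eventuallyEq.1 hx
  rw [this.gradient_eq]
  exact gradient_fun_const x 0

lemma hasCompactSupport_gradient {w : E3 → ℝ} (hw : HasCompactSupport w) :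
    HasCompactSupport (gradient w) :=
  HasCompactSupport.intro hw fun _ hx => gradient_eq_zero_of_notMem_tsupport hx

lemma integrable_of_continuousOn_isCompact {F : E3 → ℝ} {K : Set E3} (hK : IsCompact K)
    (hF : ContinuousOn F K) (h0 : ∀ x ∉ K, F x = 0) : Integrable F := by
  rw [← integrableOn_iff_integrable_of_support_subset (s := K)]
  · exact hF.integrableOn_compact hK
  · intro x hx
    by_contra hxK
    exact hx (h0 x hxK)

/-- Integration by parts against a `C¹` function compactly supported in an open set. -/
lemma integral_inner_gradient_eq {Ω : Set E3} (hΩ : IsOpen Ω) {v w : E3 → ℝ}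
    (hv : ContDiffOn ℝ 2 v Ω) (hw : ContDiff ℝ 1 w) (hc : HasCompactSupport w)
    (hs : tsupport w ⊆ Ω) :
    ∫ x, inner ℝ (gradient v x) (gradient w x) = ∫ x, -(Laplacian.laplacian v x) * w x := by
  let b := EuclideanSpace.basisFun (Fin 3) ℝ
  have hvat : ∀ x ∈ tsupport w, ContDiffAt ℝ 2 v x := fun x hx =>
    hv.contDiffAt (hΩ.mem_nhds (hs hx))
  have hfd : ∀ x ∈ tsupport w, ContDiffAt ℝ 1 (fderiv ℝ v) x := fun x hx =>
    (hvat x hx).fderiv_right (by norm_num)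
  have hg : ∀ i, ∀ x ∈ tsupport w, ContDiffAt ℝ 1 (fun y => fderiv ℝ v y (b i)) x :=
    fun i x hx => (hfd x hx).clm_apply contDiffAt_const
  have h2 : ∀ i, ∀ x ∈ tsupport w, ContinuousAt
      (fun y => fderiv ℝ (fun z => fderiv ℝ v z (b i)) y (b i)) x := fun i x hx =>
    (((hg i x hx).fderiv_right (m := 0) (by norm_num)).clm_apply contDiffAt_const).continuousAt
  have hw0 : ∀ x ∉ tsupport w, w x = 0 := fun x hx => image_eq_zero_of_notMem_tsupport hx
  have hfw : Continuous (fderiv ℝ w) := hw.continuous_fderiv one_ne_zero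
  have hfw0 : ∀ x ∉ tsupport w, fderiv ℝ w x = 0 := fun x hx =>
    image_eq_zero_of_notMem_tsupport fun h => hx (tsupport_fderiv_subset ℝ h)
  have I1 : ∀ i, Integrable fun x => fderiv ℝ w x (b i) * fderiv ℝ v x (b i) := fun i =>
    integrable_of_continuousOn_isCompact hc
      (fun x hx => ((hfw.clm_apply continuous_const).continuousAt.mul
        (hg i x hx).continuousAt).continuousWithinAt)
      (fun x hx => by simp [hfw0 x hx])
  have I2 : ∀ i, Integrable fun x =>
      w x * fderiv ℝ (fun y => fderiv ℝ v y (b i)) x (b i) := fun i =>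
    integrable_of_continuousOn_isCompact hc
      (fun x hx => (hw.continuous.continuousAt.mul (h2 i x hx)).continuousWithinAt)
      (fun x hx => by simp [hw0 x hx])
  have I3 : ∀ i, Integrable fun x => w x * fderiv ℝ v x (b i) := fun i =>
    integrable_of_continuousOn_isCompact hc
      (fun x hx => (hw.continuous.continuousAt.mul (hg i x hx).continuousAt).continuousWithinAt)
      (fun x hx => by simp [hw0 x hx])
  have key : ∀ i, ∫ x, w x * fderiv ℝ (fun y => fderiv ℝ v y (b i)) x (b i) =
      -∫ x, fderiv ℝ w x (b i) * fderiv ℝ v x (b i) := fun i =>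
    integral_mul_fderiv_eq_neg_fderiv_mul_of_integrable (I1 i) (I2 i) (I3 i)
      (fun x _ => hw.differentiable one_ne_zero x)
      (fun x hx => (hg i x hx).differentiableAt one_ne_zero)
  have e1 : ∀ x, inner ℝ (gradient v x) (gradient w x) =
      ∑ i, fderiv ℝ w x (b i) * fderiv ℝ v x (b i) := fun x => by
    rw [← b.sum_inner_mul_inner]
    refine Finset.sum_congr rfl fun i _ => ?_
    rw [inner_gradient_left, real_inner_comm, inner_gradient_left, mul_comm]
  have e2 : ∀ x, -(Laplacian.laplacian v x) * w x =
      ∑ i, -(w x * fderiv ℝ (fun y => fderiv ℝ v y (b i)) x (b i)) := fun x => by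
    by_cases hx : x ∈ tsupport w
    · rw [InnerProductSpace.laplacian_eq_iteratedFDeriv_orthonormalBasis v b]
      simp only [iteratedFDeriv_two_apply, Matrix.cons_val_zero, Matrix.cons_val_one]
      rw [Finset.sum_neg_distrib, ← Finset.mul_sum, neg_mul, mul_comm]
      congr 2
      refine Finset.sum_congr rfl fun i _ => ?_
      rw [fderiv_clm_apply ((hfd x hx).differentiableAt one_ne_zero)
        (differentiableAt_const _)]
      simp
    · simp [hw0 x hx]
  simp_rw [e1, e2]
  have I4 : ∀ i, Integrable fun x =>
      -(w x * fderiv ℝ (fun y => fderiv ℝ v y (b i)) x (b i)) := fun i => (I2 i).neg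
  rw [integral_finsetSum _ fun i _ => I1 i, integral_finsetSum _ fun i _ => I4 i]
  refine Finset.sum_congr rfl fun i _ => ?_
  rw [integral_neg, key, neg_neg]

lemma IsDirichletSolution.weak_form {Ω : Set E3} {h v w : E3 → ℝ}
    (S : IsDirichletSolution Ω h v) (hw : ContDiff ℝ 1 w) (hc : HasCompactSupport w)
    (hs : tsupport w ⊆ Ω) :
    ∫ x, inner ℝ (gradient v x) (gradient w x) = ∫ x, h x * w x := by
  rw [integral_inner_gradient_eq S.isOpen S.contDiffOn hw hc hs]
  refine integral_congr_ae (Eventually.of_forall fun x => ?_)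
  by_cases hx : x ∈ Ω
  · simp only [S.equation x hx]
  · simp [image_eq_zero_of_notMem_tsupport fun h => hx (hs h)]

lemma IsDirichletSolution.hasCompactSupport {Ω : Set E3} {h v : E3 → ℝ}
    (S : IsDirichletSolution Ω h v) : HasCompactSupport v :=
  HasCompactSupport.intro S.isBounded.isCompact_closure fun x hx =>
    S.eq_zero x fun h => hx (subset_closure h)

lemma IsDirichletSolution.hasCompactSupport_rhs {Ω : Set E3} {h v : E3 → ℝ}
    (S : IsDirichletSolution Ω h v) : HasCompactSupport h :=
  HasCompactSupport.intro S.isBounded.isCompact_closure fun x hx =>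
    S.rhs_eq_zero x fun h => hx (subset_closure h)

lemma IsDirichletSolution.nonneg {Ω : Set E3} {h v : E3 → ℝ}
    (S : IsDirichletSolution Ω h v) (x : E3) : 0 ≤ v x := by
  by_cases hx : x ∈ Ω
  · exact (S.pos x hx).le
  · exact (S.eq_zero x hx).ge

/-- A `C¹` function vanishing near `0` and on the negative axis turns `v` into a test function. -/
lemma IsDirichletSolution.comp_truncation {Ω : Set E3} {h v : E3 → ℝ}
    (S : IsDirichletSolution Ω h v) {ψ : ℝ → ℝ} (hψ : ContDiff ℝ 1 ψ) {ε : ℝ} (hε : 0 < ε)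
    (h0 : ∀ s ≤ ε, ψ s = 0) :
    ContDiff ℝ 1 (fun x => ψ (v x)) ∧ HasCompactSupport (fun x => ψ (v x)) ∧
      tsupport (fun x => ψ (v x)) ⊆ Ω ∧
      ∀ x, gradient (fun y => ψ (v y)) x = deriv ψ (v x) • gradient v x := by
  have hsub : tsupport (fun x => ψ (v x)) ⊆ {x | ε ≤ v x} := by
    refine closure_minimal (fun x hx => ?_) (isClosed_le continuous_const S.continuous)
    by_contra hlt
    exact hx (h0 _ (not_le.1 hlt).le)
  have hsubΩ : tsupport (fun x => ψ (v x)) ⊆ Ω := fun x hx => by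
    by_contra hxΩ
    have := hsub hx
    rw [mem_ofPred_eq, S.eq_zero x hxΩ] at this
    linarith
  have hat : ∀ x ∈ Ω, ContDiffAt ℝ 1 v x := fun x hx =>
    (S.contDiffOn.contDiffAt (S.isOpen.mem_nhds hx)).of_le (by norm_num)
  have hoff : ∀ x ∉ Ω, (fun y => ψ (v y)) =ᶠ[𝓝 x] fun _ => 0 := fun x hx => by
    refine notMem_tsupport_iff_eventuallyEq.1 ?_
    exact fun h => hx (hsubΩ h)
  refine ⟨?_, ?_, hsubΩ, ?_⟩
  · rw [contDiff_iff_contDiffAt]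
    intro x
    by_cases hx : x ∈ Ω
    · exact hψ.contDiffAt.comp x (hat x hx)
    · exact contDiffAt_const.congr_of_eventuallyEq (hoff x hx)
  · exact HasCompactSupport.intro S.isBounded.isCompact_closure fun x hx => by
      rw [S.eq_zero x fun h => hx (subset_closure h), h0 0 hε.le]
  · intro x
    by_cases hx : x ∈ Ω
    · have h1 : HasFDerivAt v (fderiv ℝ v x) x :=
        ((hat x hx).differentiableAt one_ne_zero).hasFDerivAt
      have h2 : HasDerivAt ψ (deriv ψ (v x)) (v x) :=
        (hψ.differentiable one_ne_zero (v x)).hasDerivAt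
      have h3 := h2.comp_hasFDerivAt x h1
      rw [gradient, show (fun y => ψ (v y)) = ψ ∘ v from rfl, h3.fderiv]
      simp [gradient]
    · rw [(hoff x hx).gradient_eq, gradient_fun_const, S.eq_zero x hx]
      -- Off `Ω` nothing is known about `gradient v`, so the factor `deriv ψ 0` has to vanish.
      have : ψ =ᶠ[𝓝 0] fun _ => 0 := by
        filter_upwards [Iio_mem_nhds hε] with s hs using h0 s (le_of_lt hs)
      rw [this.deriv_eq]
      simp

/-! ### Quantitative starshapedness -/

/-- A strictly starshaped domain is starshaped with respect to every point of a small ball. -/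
lemma lineMap_mem_of_normal_bound {Ω : Set E3} (hΩ : IsBoundedC1Domain Ω) {c : ℝ}
    (hc : ∀ x ∈ frontier Ω, ∀ ν : E3, IsOutwardUnitNormal Ω x ν → c < inner ℝ x ν)
    {x y : E3} (hx : x ∈ Ω) (hy : ‖y‖ ≤ c) {t : ℝ} (ht : t ∈ Icc (0 : ℝ) 1) :
    x + t • (y - x) ∈ Ω := by
  by_contra hcon
  let γ : ℝ → E3 := fun s => x + s • (y - x)
  have hγ : Continuous γ := by fun_prop
  have hcl : IsCompact (Icc (0 : ℝ) 1 ∩ γ ⁻¹' Ωᶜ) :=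
    isCompact_Icc.inter_right (hΩ.isOpen.isClosed_compl.preimage hγ)
  -- The first exit time of the segment from `x` to `y`; the exit point lies on the boundary.
  obtain ⟨t₀, ⟨ht₀, hz⟩, hmin⟩ := hcl.exists_isLeast ⟨t, ht, hcon⟩
  have hz' : γ t₀ ∉ Ω := hz
  have hpos : 0 < t₀ := by
    rcases ht₀.1.lt_or_eq with h | h
    · exact h
    · exfalso
      apply hz'
      simpa [γ, ← h] using hx
  have hlt : ∀ s ∈ Ico 0 t₀, γ s ∈ Ω := fun s hs => by
    by_contra h
    exact absurd (hmin ⟨⟨hs.1, hs.2.le.trans ht₀.2⟩, h⟩) (not_le.2 hs.2)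
  have hev : ∀ᶠ s in 𝓝[<] t₀, γ s ∈ Ω := by
    filter_upwards [Ico_mem_nhdsLT hpos] with s hs using hlt s hs
  have hfr : γ t₀ ∈ frontier Ω := by
    rw [hΩ.isOpen.frontier_eq]
    exact ⟨mem_closure_of_tendsto (hγ.continuousAt.tendsto.mono_left nhdsWithin_le_nhds) hev, hz'⟩
  obtain ⟨ν, hν⟩ := hΩ.exists_normal _ hfr
  have hbound := hc _ hfr ν hν
  obtain ⟨ρ, hρ, hg, hloc, rfl⟩ := hν
  have hnorm : 0 < ‖gradient ρ (γ t₀)‖ := norm_pos_iff.2 hg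
  rw [inner_smul_right, ← div_eq_inv_mul, lt_div_iff₀ hnorm] at hbound
  have hCS : inner ℝ y (gradient ρ (γ t₀)) ≤ c * ‖gradient ρ (γ t₀)‖ :=
    (real_inner_le_norm _ _).trans (mul_le_mul_of_nonneg_right hy hnorm.le)
  -- From the exit point `z`, the remaining direction `y - z` is a nonnegative multiple of `y - x`.
  -- Since `y·ν ≤ c < z·ν`, the segment would cross the boundary inwards.
  have hyz : y - γ t₀ = (1 - t₀) • (y - x) := by
    simp only [γ]
    module
  have hneg : (1 - t₀) * inner ℝ (y - x) (gradient ρ (γ t₀)) < 0 := by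
    rw [← real_inner_smul_left, ← hyz, inner_sub_left]
    linarith
  have hneg' : inner ℝ (y - x) (gradient ρ (γ t₀)) < 0 := by
    by_contra h
    exact absurd hneg (not_lt.2 (mul_nonneg (by linarith [ht₀.2]) (not_lt.1 h)))
  have hγd : HasDerivAt γ (y - x) t₀ := by
    have := ((hasDerivAt_id t₀).smul_const (y - x)).const_add x
    rwa [one_smul] at this
  have hd : HasDerivAt (fun s => ρ (γ s)) (inner ℝ (y - x) (gradient ρ (γ t₀))) t₀ := by
    have := (hρ.differentiableAt one_ne_zero).hasFDerivAt.comp_hasDerivAt t₀ hγd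
    rw [← inner_gradient_left, real_inner_comm] at this
    exact this
  have hslope : ∀ᶠ s in 𝓝[<] t₀, slope (fun s => ρ (γ s)) t₀ s < 0 :=
    ((hasDerivAt_iff_tendsto_slope.1 hd).eventually (gt_mem_nhds hneg')).filter_mono
      (nhdsWithin_mono _ fun s hs => ne_of_lt hs)
  have hloc' : ∀ᶠ s in 𝓝[<] t₀, γ s ∈ Ω ↔ ρ (γ s) < 0 :=
    (hγ.continuousAt.eventually hloc).filter_mono nhdsWithin_le_nhds
  have hzρ : 0 ≤ ρ (γ t₀) := by
    by_contra h
    exact hz' (hloc.self_of_nhds.2 (not_le.1 h))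
  obtain ⟨s, hs1, hs2, hs3, hs4⟩ :=
    (hslope.and (hloc'.and (hev.and self_mem_nhdsWithin))).exists
  have h5 := hs2.1 hs3
  -- A negative slope with `s < t₀` gives `ρ (γ s) > ρ (γ t₀) ≥ 0`, although `γ s` is still in `Ω`.
  rw [slope_def_field, div_neg_iff] at hs1
  have h6 : s < t₀ := hs4
  rcases hs1 with h | h <;> linarith [h.1, h.2]

/-- The dilated set `μ⁻¹ Ω`. -/
def dilate (Ω : Set E3) (μ : ℝ) : Set E3 := {x | μ • x ∈ Ω}

/-- `Ω` is quantitatively starshaped about the origin: the dilated set `μ⁻¹ Ω` keeps a distance of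
order `1 - μ⁻¹` from the complement of `Ω`. -/
def IsQuantStarshaped (Ω : Set E3) (c : ℝ) : Prop :=
  ∀ μ : ℝ, 1 < μ → Metric.thickening (c * (1 - μ⁻¹)) (dilate Ω μ) ⊆ Ω

lemma isQuantStarshaped_of_normal_bound {Ω : Set E3} (hΩ : IsBoundedC1Domain Ω) {c : ℝ}
    (hc : ∀ x ∈ frontier Ω, ∀ ν : E3, IsOutwardUnitNormal Ω x ν → c < inner ℝ x ν) :
    IsQuantStarshaped Ω c := by
  intro μ hμ z hz
  obtain ⟨x, hx, hxz⟩ := Metric.mem_thickening_iff.1 hz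
  have hμ0 : μ ≠ 0 := by positivity
  have ht : 0 < 1 - μ⁻¹ := by
    have := inv_lt_one_of_one_lt₀ hμ
    linarith
  have hy : ‖(1 - μ⁻¹)⁻¹ • (z - x)‖ ≤ c := by
    rw [norm_smul, norm_inv, Real.norm_of_nonneg ht.le, ← div_eq_inv_mul, div_le_iff₀ ht,
      ← dist_eq_norm]
    exact hxz.le
  -- With `y = (z - x) / (1 - μ⁻¹)`, the point `z` is the convex combination `μ⁻¹ (μ x) + (1 - μ⁻¹)
  -- y`.
  have key := lineMap_mem_of_normal_bound hΩ hc (x := μ • x) hx hy (t := 1 - μ⁻¹)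
    ⟨ht.le, by have : 0 < μ⁻¹ := by positivity
               linarith⟩
  convert key using 1
  rw [smul_sub, smul_smul, smul_smul, mul_inv_cancel₀ ht.ne', sub_mul, inv_mul_cancel₀ hμ0]
  module

lemma IsQuantStarshaped.dilate_subset {Ω : Set E3} {c : ℝ} (H : IsQuantStarshaped Ω c)
    (hc : 0 < c) {μ : ℝ} (hμ : 1 < μ) : dilate Ω μ ⊆ Ω := by
  refine (Metric.self_subset_thickening ?_ _).trans (H μ hμ)
  have := inv_lt_one_of_one_lt₀ hμ
  exact mul_pos hc (by linarith)

lemma isOpen_dilate {Ω : Set E3} (hΩ : IsOpen Ω) (μ : ℝ) : IsOpen (dilate Ω μ) :=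
  hΩ.preimage (continuous_const_smul μ)

/-! ### Cutoff functions -/

open scoped Convolution in
/-- A `C¹` cutoff function equal to `1` on `A`, supported in the `δ`-thickening of `A`, with
gradient at most `3 / δ`. -/
lemma exists_cutoff {A : Set E3} (hA : A.Nonempty) {δ : ℝ} (hδ : 0 < δ) :
    ∃ η : E3 → ℝ, ContDiff ℝ 1 η ∧ (∀ x, |η x| ≤ 1) ∧ (∀ x ∈ A, η x = 1) ∧
      tsupport η ⊆ Metric.thickening δ A ∧ ∀ x, ‖gradient η x‖ ≤ 3 / δ := by
  -- A Lipschitz cutoff that drops from 1 to 0 at distances between `δ/3` and `2δ/3`. Mollifying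
  -- keeps its Lipschitz constant `3/δ`.
  let η₀ : E3 → ℝ := fun x => max 0 (min 1 (2 - 3 / δ * Metric.infDist x A))
  have hη₀c : Continuous η₀ := by
    have := Metric.continuous_infDist_pt A
    fun_prop
  have hη₀1 : ∀ x, Metric.infDist x A ≤ δ / 3 → η₀ x = 1 := fun x hx => by
    have : 3 / δ * Metric.infDist x A ≤ 3 / δ * (δ / 3) := by gcongr
    have h2 : 3 / δ * (δ / 3) = 1 := by field_simp
    simp only [η₀]
    rw [min_eq_left (by linarith), max_eq_right zero_le_one]
  have hη₀0 : ∀ x, 2 * δ / 3 ≤ Metric.infDist x A → η₀ x = 0 := fun x hx => by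
    have : 3 / δ * (2 * δ / 3) ≤ 3 / δ * Metric.infDist x A := by gcongr
    have h2 : 3 / δ * (2 * δ / 3) = 2 := by field_simp
    simp only [η₀]
    rw [max_eq_left ((min_le_right _ _).trans (by linarith))]
  have hη₀b : ∀ x, |η₀ x| ≤ 1 := fun x => by
    rw [abs_of_nonneg (le_max_left _ _)]
    exact max_le zero_le_one (min_le_left _ _)
  have hη₀L : ∀ x y, |η₀ x - η₀ y| ≤ 3 / δ * dist x y := fun x y => by
    calc |η₀ x - η₀ y| ≤ |min 1 (2 - 3 / δ * Metric.infDist x A) -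
          min 1 (2 - 3 / δ * Metric.infDist y A)| := abs_max_sub_max_le_abs _ _ _ |>.trans' (by
            simp only [η₀]; rw [max_comm 0, max_comm 0])
      _ ≤ |(2 - 3 / δ * Metric.infDist x A) - (2 - 3 / δ * Metric.infDist y A)| := by
          refine (abs_min_sub_min_le_max _ _ _ _).trans ?_
          simp
      _ = 3 / δ * |Metric.infDist x A - Metric.infDist y A| := by
          rw [show (2 - 3 / δ * Metric.infDist x A) - (2 - 3 / δ * Metric.infDist y A) =
            -(3 / δ * (Metric.infDist x A - Metric.infDist y A)) by ring, abs_neg, abs_mul,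
            abs_of_pos (by positivity)]
      _ ≤ 3 / δ * dist x y := by
          gcongr
          have := (Metric.lipschitz_infDist_pt A).dist_le_mul x y
          simpa [Real.dist_eq] using this
  -- The radius `δ/4` is below `δ/3`, so the value 1 on `A` survives, and `2δ/3 + δ/4 = 11δ/12 < δ`
  -- keeps the support in the thickening.
  let φ : ContDiffBump (0 : E3) := ⟨δ / 8, δ / 4, by positivity, by linarith⟩
  let η : E3 → ℝ := φ.normed volume ⋆[ContinuousLinearMap.lsmul ℝ ℝ, volume] η₀
  have hφi : Integrable (φ.normed volume) volume := φ.integrable_normed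
  have hηdef : ∀ x, η x = ∫ t, φ.normed volume t * η₀ (x - t) := fun x => rfl
  have hint : ∀ x, Integrable fun t => φ.normed volume t * η₀ (x - t) := fun x =>
    hφi.mul_bdd (c := 1) (by fun_prop) (Eventually.of_forall fun t => hη₀b _)
  have hLip : ∀ x y, |η x - η y| ≤ 3 / δ * dist x y := fun x y => by
    rw [hηdef, hηdef, ← integral_sub (hint x) (hint y), ← Real.norm_eq_abs]
    refine (norm_integral_le_of_norm_le (g := fun t => φ.normed volume t * (3 / δ * dist x y))
      (hφi.mul_const _) (Eventually.of_forall fun t => ?_)).trans ?_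
    · rw [← mul_sub, Real.norm_eq_abs, abs_mul, abs_of_nonneg (φ.nonneg_normed t)]
      refine mul_le_mul_of_nonneg_left ((hη₀L _ _).trans ?_) (φ.nonneg_normed t)
      rw [dist_sub_right]
    · rw [integral_mul_const, φ.integral_normed, one_mul]
  have hcd : ContDiff ℝ 1 η :=
    φ.hasCompactSupport_normed.contDiff_convolution_left (n := 1) _ φ.contDiff_normed
      hη₀c.locallyIntegrable
  have hnear : ∀ x, ∀ y ∈ Metric.ball x (δ / 4),
      |Metric.infDist y A - Metric.infDist x A| ≤ δ / 4 := fun x y hy => by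
    have := (Metric.lipschitz_infDist_pt A).dist_le_mul y x
    rw [Real.dist_eq] at this
    have h2 := Metric.mem_ball.1 hy
    simp only [NNReal.coe_one, one_mul] at this
    linarith
  refine ⟨η, hcd, fun x => ?_, fun x hx => ?_, ?_, fun x => ?_⟩
  · rw [hηdef, ← Real.norm_eq_abs]
    refine (norm_integral_le_of_norm_le (g := fun t => φ.normed volume t) hφi
      (Eventually.of_forall fun t => ?_)).trans φ.integral_normed.le
    rw [Real.norm_eq_abs, abs_mul, abs_of_nonneg (φ.nonneg_normed t)]
    exact mul_le_of_le_one_right (φ.nonneg_normed t) (hη₀b _)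
  · have h0 : Metric.infDist x A = 0 := Metric.infDist_zero_of_mem hx
    have h1 : η₀ x = 1 := hη₀1 x (by rw [h0]; positivity)
    have := φ.normed_convolution_eq_right (g := η₀) (μ := volume) (x₀ := x) fun y hy => by
      rw [h1]
      apply hη₀1
      have := hnear x y hy
      rw [h0, sub_zero] at this
      linarith [le_abs_self (Metric.infDist y A)]
    exact this.trans h1
  · have hsub : tsupport η ⊆ {x | Metric.infDist x A ≤ 11 * δ / 12} := by
      refine closure_minimal (fun x hx => ?_)
        (isClosed_le (Metric.continuous_infDist_pt A) continuous_const)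
      by_contra hlt
      apply hx
      have hlt' : 11 * δ / 12 < Metric.infDist x A := not_le.1 hlt
      have h1 : η₀ x = 0 := hη₀0 x (by linarith)
      have := φ.normed_convolution_eq_right (g := η₀) (μ := volume) (x₀ := x) fun y hy => by
        rw [h1]
        apply hη₀0
        have := abs_le.1 (hnear x y hy)
        linarith [this.1]
      exact this.trans h1
    intro x hx
    have h := hsub hx
    rw [mem_ofPred_eq] at h
    rw [Metric.mem_thickening_iff]
    exact (Metric.infDist_lt_iff hA).1 (by linarith)
  · have hL : LipschitzWith (Real.toNNReal (3 / δ)) η := by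
      refine LipschitzWith.of_dist_le_mul fun x y => ?_
      rw [Real.coe_toNNReal _ (by positivity), Real.dist_eq]
      exact hLip x y
    rw [norm_gradient]
    have := norm_fderiv_le_of_lipschitz ℝ (x₀ := x) hL
    rwa [Real.coe_toNNReal _ (by positivity)] at this

/-! ### Truncation near zero and the energy identity -/

/-- Continuous approximation from below of the indicator of the positive half-line. -/
noncomputable def truncSlope (n : ℕ) (s : ℝ) : ℝ := max 0 (min 1 ((n + 1) * s - 1))

/-- `C¹` approximation from below of the positive part, vanishing near `0`. -/
noncomputable def trunc (n : ℕ) (s : ℝ) : ℝ := ∫ σ in (0 : ℝ)..s, truncSlope n σ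

lemma continuous_truncSlope (n : ℕ) : Continuous (truncSlope n) := by
  unfold truncSlope
  fun_prop

lemma truncSlope_nonneg (n : ℕ) (s : ℝ) : 0 ≤ truncSlope n s := le_max_left _ _

lemma truncSlope_le_one (n : ℕ) (s : ℝ) : truncSlope n s ≤ 1 :=
  max_le zero_le_one (min_le_left _ _)

lemma truncSlope_eq_zero {n : ℕ} {s : ℝ} (hs : s ≤ ((n : ℝ) + 1)⁻¹) : truncSlope n s = 0 := by
  have hn : (0 : ℝ) < n + 1 := by positivity
  have : (n + 1) * s ≤ (n + 1) * ((n : ℝ) + 1)⁻¹ := by gcongr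
  rw [mul_inv_cancel₀ hn.ne'] at this
  exact max_eq_left ((min_le_right _ _).trans (by linarith))

lemma monotone_truncSlope {s : ℝ} (hs : 0 ≤ s) : Monotone fun n => truncSlope n s := by
  intro m n hmn
  have : (m : ℝ) ≤ n := by exact_mod_cast hmn
  exact max_le_max le_rfl (min_le_min le_rfl (by gcongr))

lemma tendsto_truncSlope {s : ℝ} (hs : 0 < s) :
    Tendsto (fun n => truncSlope n s) atTop (𝓝 1) := by
  obtain ⟨N, hN⟩ := exists_nat_gt (2 / s)
  refine tendsto_const_nhds.congr' ?_
  filter_upwards [eventually_ge_atTop N] with n hn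
  have h1 : (N : ℝ) ≤ n := by exact_mod_cast hn
  have h2 : 2 ≤ (n + 1) * s := by
    rw [← div_le_iff₀ hs]
    linarith
  unfold truncSlope
  rw [min_eq_left (by linarith), max_eq_right zero_le_one]

lemma hasDerivAt_trunc (n : ℕ) (s : ℝ) : HasDerivAt (trunc n) (truncSlope n s) s :=
  intervalIntegral.integral_hasDerivAt_right ((continuous_truncSlope n).intervalIntegrable _ _)
    ((continuous_truncSlope n).stronglyMeasurableAtFilter _ _) (continuous_truncSlope n).continuousAt

lemma contDiff_trunc (n : ℕ) : ContDiff ℝ 1 (trunc n) := by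
  rw [contDiff_one_iff_deriv]
  refine ⟨fun s => (hasDerivAt_trunc n s).differentiableAt, ?_⟩
  rw [show deriv (trunc n) = truncSlope n from funext fun s => (hasDerivAt_trunc n s).deriv]
  exact continuous_truncSlope n

lemma trunc_eq_zero {n : ℕ} {s : ℝ} (hs : s ≤ ((n : ℝ) + 1)⁻¹) : trunc n s = 0 := by
  have : EqOn (truncSlope n) (fun _ => 0) (uIcc 0 s) := fun σ hσ => by
    refine truncSlope_eq_zero (hσ.2.trans (max_le ?_ hs))
    positivity
  rw [trunc, intervalIntegral.integral_congr this]
  simp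

lemma monotone_trunc (n : ℕ) : Monotone (trunc n) :=
  monotone_of_deriv_nonneg (fun s => (hasDerivAt_trunc n s).differentiableAt) fun s => by
    rw [(hasDerivAt_trunc n s).deriv]
    exact truncSlope_nonneg n s

lemma trunc_nonneg (n : ℕ) (s : ℝ) : 0 ≤ trunc n s := by
  rcases le_total s 0 with h | h
  · rw [trunc_eq_zero (h.trans (by positivity))]
  · rw [← trunc_eq_zero (n := n) (s := 0) (by positivity)]
    exact monotone_trunc n h

lemma trunc_le {n : ℕ} {s : ℝ} (hs : 0 ≤ s) : trunc n s ≤ s := by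
  have : trunc n s ≤ ∫ _ in (0 : ℝ)..s, (1 : ℝ) :=
    intervalIntegral.integral_mono_on hs ((continuous_truncSlope n).intervalIntegrable _ _)
      (continuous_const.intervalIntegrable _ _) fun σ _ => truncSlope_le_one n σ
  simpa using this

lemma abs_trunc_le {n : ℕ} {s : ℝ} (hs : 0 ≤ s) : |trunc n s| ≤ s := by
  rw [abs_of_nonneg (trunc_nonneg n s)]
  exact trunc_le hs

lemma tendsto_trunc {s : ℝ} (hs : 0 ≤ s) : Tendsto (fun n => trunc n s) atTop (𝓝 s) := by
  have : Tendsto (fun n => trunc n s) atTop (𝓝 (∫ _ in (0 : ℝ)..s, (1 : ℝ))) := by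
    refine intervalIntegral.tendsto_integral_filter_of_dominated_convergence (fun _ => 1)
      (Eventually.of_forall fun n => (continuous_truncSlope n).aestronglyMeasurable)
      (Eventually.of_forall fun n => Eventually.of_forall fun σ _ => ?_)
      (continuous_const.intervalIntegrable _ _) (Eventually.of_forall fun σ hσ => ?_)
    · rw [Real.norm_of_nonneg (truncSlope_nonneg n σ)]
      exact truncSlope_le_one n σ
    · rw [uIoc_of_le hs] at hσ
      exact tendsto_truncSlope hσ.1
  simpa using this

lemma integrable_norm_gradient_sq {w : E3 → ℝ} (hw : ContDiff ℝ 1 w) (hc : HasCompactSupport w) :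
    Integrable fun x => ‖gradient w x‖ ^ 2 :=
  (hw.continuous_gradient.norm.pow 2).integrable_of_hasCompactSupport
    (HasCompactSupport.intro hc fun x hx => by
      rw [Pi.pow_apply, gradient_eq_zero_of_notMem_tsupport hx, norm_zero, zero_pow two_ne_zero])

namespace IsDirichletSolution

variable {Ω : Set E3} {h v : E3 → ℝ}

lemma trunc_comp (S : IsDirichletSolution Ω h v) (n : ℕ) :
    ContDiff ℝ 1 (fun x => trunc n (v x)) ∧ HasCompactSupport (fun x => trunc n (v x)) ∧
      tsupport (fun x => trunc n (v x)) ⊆ Ω ∧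
      ∀ x, gradient (fun y => trunc n (v y)) x = truncSlope n (v x) • gradient v x := by
  have := S.comp_truncation (contDiff_trunc n) (ε := ((n : ℝ) + 1)⁻¹) (by positivity)
    fun s hs => trunc_eq_zero hs
  refine ⟨this.1, this.2.1, this.2.2.1, fun x => ?_⟩
  rw [this.2.2.2, (hasDerivAt_trunc n _).deriv]

lemma integrable_rhs_mul (S : IsDirichletSolution Ω h v) {w : E3 → ℝ} (hw : Continuous w) :
    Integrable fun x => h x * w x :=
  (S.continuous_rhs.mul hw).integrable_of_hasCompactSupport S.hasCompactSupport_rhs.mul_right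

lemma tendsto_integral_rhs_mul_trunc (S : IsDirichletSolution Ω h v) {g : E3 → E3}
    (hg : Continuous g) :
    Tendsto (fun n => ∫ x, h x * trunc n (v (g x))) atTop (𝓝 (∫ x, h x * v (g x))) := by
  refine tendsto_integral_of_dominated_convergence (fun x => |h x| * v (g x)) (fun n => ?_) ?_
    (fun n => Eventually.of_forall fun x => ?_) (Eventually.of_forall fun x => ?_)
  · exact (S.continuous_rhs.mul
      ((contDiff_trunc n).continuous.comp (S.continuous.comp hg))).aestronglyMeasurable
  · exact (S.continuous_rhs.abs.mul (S.continuous.comp hg)).integrable_of_hasCompactSupport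
      (S.hasCompactSupport_rhs.abs.mul_right)
  · rw [norm_mul, Real.norm_eq_abs, Real.norm_eq_abs]
    exact mul_le_mul_of_nonneg_left (abs_trunc_le (S.nonneg _)) (abs_nonneg _)
  · exact (tendsto_trunc (S.nonneg _)).const_mul _

lemma aestronglyMeasurable_gradient (S : IsDirichletSolution Ω h v) :
    AEStronglyMeasurable (gradient v) (volume.restrict Ω) :=
  (S.contDiffOn.continuousOn_gradient S.isOpen).aestronglyMeasurable S.isOpen.measurableSet

/-- Testing with `trunc n ∘ v` is legitimate because its support is compact in `Ω`. Monotone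
convergence on the gradient side and dominated convergence on the other give finiteness of the
energy and its value together. -/
lemma energy (S : IsDirichletSolution Ω h v) :
    IntegrableOn (fun x => ‖gradient v x‖ ^ 2) Ω ∧
      ∫ x in Ω, ‖gradient v x‖ ^ 2 = ∫ x, h x * v x := by
  have hn : ∀ n, ∫⁻ x in Ω, ENNReal.ofReal (truncSlope n (v x) * ‖gradient v x‖ ^ 2) =
      ENNReal.ofReal (∫ x, h x * trunc n (v x)) := fun n => by
    obtain ⟨h1, h2, h3, h4⟩ := S.trunc_comp n
    have hpt : ∀ x, inner ℝ (gradient v x) (gradient (fun y => trunc n (v y)) x) =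
        truncSlope n (v x) * ‖gradient v x‖ ^ 2 := fun x => by
      rw [h4, inner_smul_right, real_inner_self_eq_norm_sq]
    have hoff : ∀ x ∉ tsupport (fun x => trunc n (v x)),
        truncSlope n (v x) * ‖gradient v x‖ ^ 2 = 0 := fun x hx => by
      rw [← hpt, gradient_eq_zero_of_notMem_tsupport hx, inner_zero_right]
    have hi : Integrable fun x => truncSlope n (v x) * ‖gradient v x‖ ^ 2 := by
      refine integrable_of_continuousOn_isCompact h2 ?_ hoff
      exact (((continuous_truncSlope n).comp S.continuous).continuousOn).mul
        (((S.contDiffOn.continuousOn_gradient S.isOpen).mono h3).norm.pow 2)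
    rw [← S.weak_form h1 h2 h3]
    simp_rw [hpt]
    rw [← setIntegral_eq_integral_of_forall_compl_eq_zero (s := Ω)
      fun x hx => hoff x fun hx' => hx (h3 hx')]
    rw [ofReal_integral_eq_lintegral_ofReal hi.integrableOn]
    exact Eventually.of_forall fun x => mul_nonneg (truncSlope_nonneg _ _) (sq_nonneg _)
  have hlim1 : Tendsto (fun n => ∫⁻ x in Ω,
      ENNReal.ofReal (truncSlope n (v x) * ‖gradient v x‖ ^ 2)) atTop
      (𝓝 (∫⁻ x in Ω, ENNReal.ofReal (‖gradient v x‖ ^ 2))) := by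
    refine lintegral_tendsto_of_tendsto_of_monotone (fun n => ?_)
      (Eventually.of_forall fun x m n hmn => ?_) ?_
    · exact (((continuous_truncSlope n).comp S.continuous).aestronglyMeasurable.mul
        (S.aestronglyMeasurable_gradient.norm.pow 2)).aemeasurable.ennreal_ofReal
    · exact ENNReal.ofReal_le_ofReal
        (mul_le_mul_of_nonneg_right (monotone_truncSlope (S.nonneg x) hmn) (sq_nonneg _))
    · filter_upwards [ae_restrict_mem S.isOpen.measurableSet] with x hx
      refine ENNReal.tendsto_ofReal ?_
      simpa using (tendsto_truncSlope (S.pos x hx)).mul_const (‖gradient v x‖ ^ 2)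
  have hlim2 := ENNReal.tendsto_ofReal (S.tendsto_integral_rhs_mul_trunc continuous_id)
  simp_rw [hn] at hlim1
  have heq := tendsto_nhds_unique hlim1 hlim2
  have hpos : 0 ≤ ∫ x, h x * v x := by
    refine ge_of_tendsto' (S.tendsto_integral_rhs_mul_trunc continuous_id) fun n => ?_
    obtain ⟨h1, h2, h3, h4⟩ := S.trunc_comp n
    change 0 ≤ ∫ x, h x * trunc n (v x)
    rw [← S.weak_form h1 h2 h3]
    refine integral_nonneg fun x => ?_
    rw [h4, inner_smul_right, real_inner_self_eq_norm_sq]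
    exact mul_nonneg (truncSlope_nonneg _ _) (sq_nonneg _)
  have hmeas : AEStronglyMeasurable (fun x => ‖gradient v x‖ ^ 2) (volume.restrict Ω) :=
    S.aestronglyMeasurable_gradient.norm.pow 2
  have hint : IntegrableOn (fun x => ‖gradient v x‖ ^ 2) Ω := by
    refine ⟨hmeas, ?_⟩
    rw [hasFiniteIntegral_iff_ofReal (Eventually.of_forall fun x => sq_nonneg _), heq]
    exact ENNReal.ofReal_lt_top
  refine ⟨hint, ?_⟩
  rw [integral_eq_lintegral_of_nonneg_ae (Eventually.of_forall fun x => sq_nonneg _) hmeas, heq]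
  exact ENNReal.toReal_ofReal hpos

lemma integral_norm_gradient_trunc_sq_le (S : IsDirichletSolution Ω h v) (n : ℕ) :
    ∫ x, ‖gradient (fun y => trunc n (v y)) x‖ ^ 2 ≤ ∫ x, h x * v x := by
  obtain ⟨h1, h2, h3, h4⟩ := S.trunc_comp n
  have hoff : ∀ x ∉ Ω, ‖gradient (fun y => trunc n (v y)) x‖ ^ 2 = 0 := fun x hx => by
    rw [gradient_eq_zero_of_notMem_tsupport fun hx' => hx (h3 hx'), norm_zero,
      zero_pow two_ne_zero]
  rw [← S.energy.2, ← setIntegral_eq_integral_of_forall_compl_eq_zero hoff]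
  refine setIntegral_mono_on (integrable_norm_gradient_sq h1 h2).integrableOn S.energy.1
    S.isOpen.measurableSet fun x _ => ?_
  rw [h4, norm_smul, mul_pow, Real.norm_of_nonneg (truncSlope_nonneg _ _)]
  exact mul_le_of_le_one_left (sq_nonneg _)
    (pow_le_one₀ (truncSlope_nonneg _ _) (truncSlope_le_one _ _))

end IsDirichletSolution

/-! ### Dilations and the boundary layer -/

lemma gradient_comp_smul {w : E3 → ℝ} (hw : ContDiff ℝ 1 w) (μ : ℝ) (x : E3) :
    gradient (fun y => w (μ • y)) x = μ • gradient w (μ • x) := by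
  have h1 : HasFDerivAt (fun y : E3 => μ • y) (μ • ContinuousLinearMap.id ℝ E3) x :=
    (hasFDerivAt_id x).const_smul μ
  have h2 := (hw.differentiable one_ne_zero (μ • x)).hasFDerivAt.comp x h1
  have h3 : fderiv ℝ (fun y => w (μ • y)) x = μ • fderiv ℝ w (μ • x) := by
    refine h2.fderiv.trans ?_
    ext z
    simp
  rw [gradient, h3]
  simp [gradient]

lemma tsupport_comp_smul_subset (w : E3 → ℝ) (μ : ℝ) :
    tsupport (fun y => w (μ • y)) ⊆ (fun y => μ • y) ⁻¹' tsupport w :=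
  tsupport_comp_subset_preimage w (continuous_const_smul μ)

/-- Comparing the energy of `v` with that of the dilated function `x ↦ v (μ x)`. -/
lemma IsDirichletSolution.energy_layer_le {Ω : Set E3} {h v : E3 → ℝ}
    (S : IsDirichletSolution Ω h v) {μ : ℝ} (hμ : 1 < μ) (hsub : dilate Ω μ ⊆ Ω) :
    ∫ x in Ω \ dilate Ω μ, ‖gradient v x‖ ^ 2 ≤
      (1 + μ⁻¹) * (∫ x, h x * v x) - 2 * ∫ x, h x * v (μ • x) := by
  have hμ0 : 0 < μ := by linarith
  have hlim := (((S.tendsto_integral_rhs_mul_trunc (continuous_const_smul μ)).const_mul 2)).const_sub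
    ((1 + μ⁻¹) * (∫ x, h x * v x))
  refine ge_of_tendsto' hlim fun n => ?_
  obtain ⟨h1, h2, h3, h4⟩ := S.trunc_comp n
  set W : E3 → ℝ := fun x => trunc n (v x) with hW
  let w : E3 → ℝ := fun x => W (μ • x)
  have hw : ContDiff ℝ 1 w := h1.comp (contDiff_const_smul μ)
  have hwt : tsupport w ⊆ dilate Ω μ := (tsupport_comp_smul_subset W μ).trans
    fun x hx => h3 hx
  have hwc : HasCompactSupport w := h2.comp_smul hμ0.ne'
  have hgw : ∀ x ∉ dilate Ω μ, gradient w x = 0 := fun x hx =>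
    gradient_eq_zero_of_notMem_tsupport fun hx' => hx (hwt hx')
  have hgwc : Continuous (gradient w) := hw.continuous_gradient
  have hmO := S.isOpen.measurableSet
  have I2 : Integrable fun x => ‖gradient w x‖ ^ 2 := integrable_norm_gradient_sq hw hwc
  have I1 : Integrable fun x => inner ℝ (gradient v x) (gradient w x) := by
    refine integrable_of_continuousOn_isCompact (K := tsupport w) hwc ?_ fun x hx => ?_
    · exact ((S.contDiffOn.continuousOn_gradient S.isOpen).mono (hwt.trans hsub)).inner
        hgwc.continuousOn
    · rw [gradient_eq_zero_of_notMem_tsupport hx, inner_zero_right]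
  have hexp : ∀ x, ‖gradient v x - gradient w x‖ ^ 2 =
      ‖gradient v x‖ ^ 2 - 2 * inner ℝ (gradient v x) (gradient w x) + ‖gradient w x‖ ^ 2 :=
    fun x => norm_sub_sq_real _ _
  have I3 : IntegrableOn (fun x => ‖gradient v x - gradient w x‖ ^ 2) Ω := by
    simp_rw [hexp]
    exact (S.energy.1.sub (I1.integrableOn.const_mul 2)).add I2.integrableOn
  -- The cross term is the weak form of the equation tested with the dilated truncation, which is
  -- supported in `dilate Ω μ ⊆ Ω`.
  have e1 : ∫ x in Ω, ‖gradient v x - gradient w x‖ ^ 2 =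
      (∫ x, h x * v x) - 2 * (∫ x, h x * w x) + ∫ x in Ω, ‖gradient w x‖ ^ 2 := by
    simp_rw [hexp]
    have I4 : IntegrableOn (fun x => ‖gradient v x‖ ^ 2 -
      2 * inner ℝ (gradient v x) (gradient w x)) Ω := S.energy.1.sub (I1.integrableOn.const_mul 2)
    rw [integral_add I4 I2.integrableOn,
      integral_sub S.energy.1 (I1.integrableOn.const_mul 2), integral_const_mul, S.energy.2,
      setIntegral_eq_integral_of_forall_compl_eq_zero (s := Ω) (fun x hx => by
        rw [hgw x fun hx' => hx (hsub hx'), inner_zero_right]),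
      S.weak_form hw hwc (hwt.trans hsub)]
  -- Dirichlet energy scales by `μ² · μ⁻³ = μ⁻¹` in dimension three.
  have e2 : ∫ x in Ω, ‖gradient w x‖ ^ 2 ≤ μ⁻¹ * ∫ x, h x * v x := by
    rw [setIntegral_eq_integral_of_forall_compl_eq_zero (s := Ω) fun x hx => by
      rw [hgw x fun hx' => hx (hsub hx')]; simp]
    have : ∀ x, ‖gradient w x‖ ^ 2 = μ ^ 2 * ‖gradient W (μ • x)‖ ^ 2 := fun x => by
      simp only [w, gradient_comp_smul h1, norm_smul, mul_pow, Real.norm_of_nonneg hμ0.le]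
    simp_rw [this]
    rw [integral_const_mul, Measure.integral_comp_smul volume (fun y => ‖gradient W y‖ ^ 2), finrank_euclideanSpace_fin,
      abs_of_pos (by positivity), smul_eq_mul, ← mul_assoc]
    have h5 : μ ^ 2 * (μ ^ 3)⁻¹ = μ⁻¹ := by field_simp
    rw [h5]
    exact mul_le_mul_of_nonneg_left (S.integral_norm_gradient_trunc_sq_le n) (by positivity)
  -- In the layer `w` has zero gradient, so the energy of `v - w` there is that of `v`.
  have e3 : ∫ x in Ω \ dilate Ω μ, ‖gradient v x‖ ^ 2 ≤
      ∫ x in Ω, ‖gradient v x - gradient w x‖ ^ 2 := by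
    have hm : MeasurableSet (Ω \ dilate Ω μ) := hmO.diff (isOpen_dilate S.isOpen μ).measurableSet
    rw [setIntegral_congr_fun hm (g := fun x => ‖gradient v x - gradient w x‖ ^ 2) fun x hx => by
      simp only [hgw x hx.2, sub_zero]]
    exact setIntegral_mono_set I3 (Eventually.of_forall fun x => sq_nonneg _)
      (Eventually.of_forall sdiff_subset)
  have e4 : ∫ x, h x * w x = ∫ x, h x * trunc n (v (μ • x)) := rfl
  rw [← e4]
  linarith

/-- The quadratic polynomial `a ↦ ∫ (g - a)²` is nonnegative, so its discriminant is not positive.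
-/
lemma sq_integral_le_measureReal_mul {α : Type*} [MeasurableSpace α] {ν : Measure α}
    [IsFiniteMeasure ν] {g : α → ℝ} (hg : Integrable g ν) (hg2 : Integrable (fun x => g x ^ 2) ν) :
    (∫ x, g x ∂ν) ^ 2 ≤ ν.real univ * ∫ x, g x ^ 2 ∂ν := by
  have key : ∀ a : ℝ, 0 ≤ ν.real univ * (a * a) + (-2 * ∫ x, g x ∂ν) * a + ∫ x, g x ^ 2 ∂ν := by
    intro a
    have h1 : 0 ≤ ∫ x, (g x - a) ^ 2 ∂ν := integral_nonneg fun x => sq_nonneg _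
    have h2 : ∀ x, (g x - a) ^ 2 = g x ^ 2 - 2 * a * g x + a * a := fun x => by ring
    simp_rw [h2] at h1
    have I : Integrable (fun x => g x ^ 2 - 2 * a * g x) ν := hg2.sub (hg.const_mul _)
    rw [integral_add I (integrable_const _), integral_sub hg2 (hg.const_mul _), integral_const_mul,
      integral_const, smul_eq_mul] at h1
    linarith
  have := discrim_le_zero key
  rw [discrim] at this
  nlinarith

/-- Write the increment as the integral of `∇w(t x)·x` over `1 < t ≤ μ` and exchange the integrals.
For `t ≥ 1` the integrand lives on `‖x‖ ≤ R`, and the Jacobian `t⁻³` is at most 1. -/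
lemma integral_abs_comp_smul_sub_le {w : E3 → ℝ} (hw : ContDiff ℝ 1 w) (hc : HasCompactSupport w)
    {R : ℝ} (hR : tsupport w ⊆ Metric.closedBall 0 R) (hR0 : 0 ≤ R) {μ : ℝ} (hμ : 1 ≤ μ) :
    ∫ x, |w (μ • x) - w x| ≤ R * (∫ x, ‖gradient w x‖) * (μ - 1) := by
  have hμ0 : 0 < μ := by linarith
  have hfw : Continuous (fderiv ℝ w) := hw.continuous_fderiv one_ne_zero
  have hI : Integrable fun x => ‖gradient w x‖ :=
    hw.continuous_gradient.norm.integrable_of_hasCompactSupport (hasCompactSupport_gradient hc).norm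
  set D := ∫ x, ‖gradient w x‖ with hD
  have hD0 : 0 ≤ D := integral_nonneg fun x => norm_nonneg _
  have hderiv : ∀ (x : E3) (t : ℝ), HasDerivAt (fun t : ℝ => w (t • x)) (fderiv ℝ w (t • x) x) t :=
    fun x t => by
      have h1 : HasDerivAt (fun t : ℝ => t • x) x t := by
        have := (hasDerivAt_id t).smul_const x
        rwa [one_smul] at this
      exact (hw.differentiable one_ne_zero (t • x)).hasFDerivAt.comp_hasDerivAt t h1
  have hcont2 : Continuous fun p : E3 × ℝ => fderiv ℝ w (p.2 • p.1) p.1 :=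
    (hfw.comp (continuous_snd.smul continuous_fst)).clm_apply continuous_fst
  have hpt : ∀ x : E3, ‖w (μ • x) - w x‖ₑ ≤
      ∫⁻ t in Ioc 1 μ, ‖fderiv ℝ w (t • x) x‖ₑ := fun x => by
    have hcx : Continuous fun t : ℝ => fderiv ℝ w (t • x) x :=
      hcont2.comp (Continuous.prodMk_right x)
    have := intervalIntegral.integral_eq_sub_of_hasDerivAt (fun t _ => hderiv x t)
      (hcx.intervalIntegrable 1 μ)
    rw [one_smul] at this
    rw [← this, intervalIntegral.integral_of_le hμ]
    exact enorm_integral_le_lintegral_enorm _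
  have hin : ∀ t ∈ Ioc 1 μ, ∫⁻ x, ‖fderiv ℝ w (t • x) x‖ₑ ≤ ENNReal.ofReal (R * D) := by
    intro t ht
    have ht0 : 0 < t := by linarith [ht.1]
    have hle : ∀ x : E3, ‖fderiv ℝ w (t • x) x‖ₑ ≤ ENNReal.ofReal (R * ‖gradient w (t • x)‖) := by
      intro x
      rw [← ofReal_norm]
      refine ENNReal.ofReal_le_ofReal ?_
      by_cases hx : t • x ∈ tsupport w
      · have h1 := hR hx
        rw [mem_closedBall_zero_iff, norm_smul, Real.norm_of_nonneg ht0.le] at h1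
        have h2 : ‖x‖ ≤ R := by nlinarith [norm_nonneg x, ht.1]
        refine ((fderiv ℝ w (t • x)).le_opNorm x).trans ?_
        rw [mul_comm, norm_gradient]
        gcongr
      · have := gradient_eq_zero_of_notMem_tsupport hx
        rw [← norm_eq_zero, norm_gradient, norm_eq_zero] at this
        rw [this]
        simpa using mul_nonneg hR0 (norm_nonneg _)
    refine (lintegral_mono hle).trans ?_
    rw [← ofReal_integral_eq_lintegral_ofReal ((hI.comp_smul ht0.ne').const_mul R)
      (Eventually.of_forall fun x => mul_nonneg hR0 (norm_nonneg _)), integral_const_mul,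
      Measure.integral_comp_smul volume (fun y => ‖gradient w y‖), finrank_euclideanSpace_fin,
      abs_of_pos (by positivity), smul_eq_mul, ← hD]
    refine ENNReal.ofReal_le_ofReal (mul_le_mul_of_nonneg_left ?_ hR0)
    exact mul_le_of_le_one_left hD0 (inv_le_one_of_one_le₀ (one_le_pow₀ ht.1.le))
  have hwμ : Continuous fun x => |w (μ • x) - w x| :=
    ((hw.continuous.comp (continuous_const_smul μ)).sub hw.continuous).abs
  have hfin : ∫⁻ x, ENNReal.ofReal |w (μ • x) - w x| ≤ ENNReal.ofReal (R * D * (μ - 1)) := by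
    calc ∫⁻ x, ENNReal.ofReal |w (μ • x) - w x|
        ≤ ∫⁻ x, ∫⁻ t in Ioc 1 μ, ‖fderiv ℝ w (t • x) x‖ₑ := lintegral_mono fun x => by
          rw [← Real.norm_eq_abs, ofReal_norm]
          exact hpt x
      _ = ∫⁻ t in Ioc 1 μ, ∫⁻ x, ‖fderiv ℝ w (t • x) x‖ₑ :=
          lintegral_lintegral_swap hcont2.enorm.measurable.aemeasurable
      _ ≤ ∫⁻ _ in Ioc 1 μ, ENNReal.ofReal (R * D) :=
          setLIntegral_mono measurable_const hin
      _ = ENNReal.ofReal (R * D * (μ - 1)) := by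
          rw [setLIntegral_const, Real.volume_Ioc, ← ENNReal.ofReal_mul (mul_nonneg hR0 hD0)]
  rw [integral_eq_lintegral_of_nonneg_ae (Eventually.of_forall fun x => abs_nonneg _)
    hwμ.aestronglyMeasurable]
  exact ENNReal.toReal_le_of_le_ofReal
    (mul_nonneg (mul_nonneg hR0 hD0) (by linarith)) hfin

lemma measureReal_diff_dilate {Ω : Set E3} (hΩ : IsOpen Ω) (hb : Bornology.IsBounded Ω) {μ : ℝ}
    (hμ : 0 < μ) (hsub : dilate Ω μ ⊆ Ω) :
    volume.real (Ω \ dilate Ω μ) = (1 - μ⁻¹ ^ 3) * volume.real Ω := by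
  have hfin : volume Ω ≠ ⊤ := hb.measure_lt_top.ne
  have h1 : volume.real (dilate Ω μ) = μ⁻¹ ^ 3 * volume.real Ω := by
    have := Measure.addHaar_preimage_smul (volume : Measure E3) hμ.ne' Ω
    rw [finrank_euclideanSpace_fin, abs_of_pos (by positivity)] at this
    rw [measureReal_def, show dilate Ω μ = (μ • ·) ⁻¹' Ω from rfl, this, ENNReal.toReal_mul,
      ENNReal.toReal_ofReal (by positivity), inv_pow, measureReal_def]
  rw [measureReal_sdiff hsub (isOpen_dilate hΩ μ).measurableSet
    hfin, h1]
  ring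

namespace IsDirichletSolution

variable {Ω : Set E3} {h v : E3 → ℝ}

lemma integrableOn_norm_gradient (S : IsDirichletSolution Ω h v) :
    IntegrableOn (fun x => ‖gradient v x‖) Ω := by
  have : Fact (volume Ω < ⊤) := ⟨S.isBounded.measure_lt_top⟩
  have h2 : MemLp (fun x => ‖gradient v x‖) 2 (volume.restrict Ω) :=
    (memLp_two_iff_integrable_sq S.aestronglyMeasurable_gradient.norm).2 S.energy.1
  exact h2.integrable one_le_two

/-- This linear rate in `μ - 1` makes the Taylor error in `pohozaev` negligible after division by `1
- μ⁻¹`. -/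
lemma exists_integral_abs_comp_smul_sub_le (S : IsDirichletSolution Ω h v) :
    ∃ K : ℝ, 0 ≤ K ∧ ∀ μ : ℝ, 1 ≤ μ → ∫ x, |v (μ • x) - v x| ≤ K * (μ - 1) := by
  obtain ⟨R, hR0, hR⟩ := S.isBounded.subset_closedBall_lt 0 (0 : E3)
  refine ⟨R * ∫ x in Ω, ‖gradient v x‖,
    mul_nonneg hR0.le (integral_nonneg fun x => norm_nonneg _), fun μ hμ => ?_⟩
  have hvμ : Continuous fun x => v (μ • x) := S.continuous.comp (continuous_const_smul μ)
  have hvc : HasCompactSupport fun x => v (μ • x) :=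
    S.hasCompactSupport.comp_smul (by linarith : μ ≠ 0)
  have hlim : Tendsto (fun n => ∫ x, |trunc n (v (μ • x)) - trunc n (v x)|) atTop
      (𝓝 (∫ x, |v (μ • x) - v x|)) := by
    refine tendsto_integral_of_dominated_convergence (fun x => v (μ • x) + v x) (fun n => ?_)
      ((hvμ.integrable_of_hasCompactSupport hvc).add
        (S.continuous.integrable_of_hasCompactSupport S.hasCompactSupport))
      (fun n => Eventually.of_forall fun x => ?_) (Eventually.of_forall fun x => ?_)
    · exact (((contDiff_trunc n).continuous.comp hvμ).sub
        ((contDiff_trunc n).continuous.comp S.continuous)).abs.aestronglyMeasurable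
    · rw [Real.norm_eq_abs, abs_abs]
      exact (abs_sub _ _).trans (add_le_add (abs_trunc_le (S.nonneg _)) (abs_trunc_le (S.nonneg _)))
    · exact ((tendsto_trunc (S.nonneg _)).sub (tendsto_trunc (S.nonneg _))).abs
  refine le_of_tendsto' hlim fun n => ?_
  obtain ⟨h1, h2, h3, h4⟩ := S.trunc_comp n
  refine (integral_abs_comp_smul_sub_le h1 h2 (h3.trans hR) hR0.le hμ).trans ?_
  gcongr
  rw [← setIntegral_eq_integral_of_forall_compl_eq_zero (s := Ω) fun x hx => by
    rw [gradient_eq_zero_of_notMem_tsupport fun hx' => hx (h3 hx'), norm_zero]]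
  refine setIntegral_mono_on (h1.continuous_gradient.norm.integrable_of_hasCompactSupport
    (hasCompactSupport_gradient h2).norm).integrableOn S.integrableOn_norm_gradient
    S.isOpen.measurableSet fun x _ => ?_
  rw [h4, norm_smul, Real.norm_of_nonneg (truncSlope_nonneg _ _)]
  exact mul_le_of_le_one_left (norm_nonneg _) (truncSlope_le_one _ _)

/-- The flux through the boundary layer `Ω \ μ⁻¹Ω` bounds the energy in the layer from below. -/
lemma flux_sq_le (S : IsDirichletSolution Ω h v) {μ : ℝ}
    {η : E3 → ℝ} (hη : ContDiff ℝ 1 η) (hs : tsupport η ⊆ Ω) (h1 : ∀ x ∈ dilate Ω μ, η x = 1)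
    {L : ℝ} (hL : ∀ x, ‖gradient η x‖ ≤ L) :
    (∫ x, h x * η x) ^ 2 ≤ L ^ 2 * volume.real (Ω \ dilate Ω μ) *
      ∫ x in Ω \ dilate Ω μ, ‖gradient v x‖ ^ 2 := by
  have hc : HasCompactSupport η :=
    S.isBounded.isCompact_closure.of_isClosed_subset (isClosed_tsupport η)
      (hs.trans subset_closure)
  have hm : MeasurableSet (Ω \ dilate Ω μ) :=
    S.isOpen.measurableSet.diff (isOpen_dilate S.isOpen μ).measurableSet
  have : Fact (volume (Ω \ dilate Ω μ) < ⊤) :=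
    ⟨(S.isBounded.subset sdiff_subset).measure_lt_top⟩
  -- The cutoff is constant on the open set `dilate Ω μ`, so only the layer contributes to the weak
  -- form; Cauchy–Schwarz is applied there.
  have hg0 : ∀ x ∉ Ω \ dilate Ω μ, gradient η x = 0 := fun x hx => by
    by_cases hxd : x ∈ dilate Ω μ
    · have : η =ᶠ[𝓝 x] fun _ => 1 := by
        filter_upwards [(isOpen_dilate S.isOpen μ).mem_nhds hxd] with y hy using h1 y hy
      rw [this.gradient_eq, gradient_fun_const]
    · exact gradient_eq_zero_of_notMem_tsupport fun hx' => hx ⟨hs hx', hxd⟩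
  have hL0 : 0 ≤ L := (norm_nonneg _).trans (hL 0)
  have i1 : IntegrableOn (fun x => ‖gradient v x‖) (Ω \ dilate Ω μ) :=
    S.integrableOn_norm_gradient.mono_set sdiff_subset
  have i2 : IntegrableOn (fun x => ‖gradient v x‖ ^ 2) (Ω \ dilate Ω μ) :=
    S.energy.1.mono_set sdiff_subset
  have hle : |∫ x, h x * η x| ≤ L * ∫ x in Ω \ dilate Ω μ, ‖gradient v x‖ := by
    rw [← S.weak_form hη hc hs, ← setIntegral_eq_integral_of_forall_compl_eq_zero
      (s := Ω \ dilate Ω μ) (fun x hx => by rw [hg0 x hx, inner_zero_right]),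
      ← integral_const_mul, ← Real.norm_eq_abs]
    refine norm_integral_le_of_norm_le (i1.const_mul L) (Eventually.of_forall fun x => ?_)
    rw [mul_comm]
    exact (norm_inner_le_norm _ _).trans (mul_le_mul_of_nonneg_left (hL x) (norm_nonneg _))
  have hcs := sq_integral_le_measureReal_mul i1 i2
  rw [measureReal_restrict_apply_univ] at hcs
  calc (∫ x, h x * η x) ^ 2 = |∫ x, h x * η x| ^ 2 := (sq_abs _).symm
    _ ≤ (L * ∫ x in Ω \ dilate Ω μ, ‖gradient v x‖) ^ 2 := by gcongr
    _ = L ^ 2 * (∫ x in Ω \ dilate Ω μ, ‖gradient v x‖) ^ 2 := mul_pow _ _ _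
    _ ≤ L ^ 2 * (volume.real (Ω \ dilate Ω μ) * ∫ x in Ω \ dilate Ω μ, ‖gradient v x‖ ^ 2) := by
        gcongr
    _ = _ := by ring

lemma eventually_abs_comp_smul_sub_lt (S : IsDirichletSolution Ω h v) {δ : ℝ} (hδ : 0 < δ) :
    ∀ᶠ μ in 𝓝[>] (1 : ℝ), ∀ x, |v (μ • x) - v x| < δ := by
  obtain ⟨R, hR0, hR⟩ := S.isBounded.subset_closedBall_lt 0 (0 : E3)
  obtain ⟨r, hr, hur⟩ := Metric.uniformContinuous_iff.1
    (S.hasCompactSupport.uniformContinuous_of_continuous S.continuous) δ hδ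
  have : Ioo (1 : ℝ) (1 + r / R) ∈ 𝓝[>] (1 : ℝ) :=
    Ioo_mem_nhdsGT (by linarith [div_pos hr hR0])
  filter_upwards [this] with μ hμ x
  by_cases hx : ‖x‖ ≤ R
  · rw [← Real.dist_eq]
    refine hur ?_
    have h1 : (μ - 1) * R < r := by
      rw [← lt_div_iff₀ hR0]
      linarith [hμ.2]
    rw [dist_eq_norm, show μ • x - x = (μ - 1) • x by rw [sub_smul, one_smul], norm_smul,
      Real.norm_of_nonneg (by linarith [hμ.1])]
    exact (mul_le_mul_of_nonneg_left hx (by linarith [hμ.1])).trans_lt h1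
  · have hx' := not_le.1 hx
    have h1 : x ∉ Ω := fun hxΩ => hx (mem_closedBall_zero_iff.1 (hR hxΩ))
    have h2 : μ • x ∉ Ω := fun hxΩ => by
      have := mem_closedBall_zero_iff.1 (hR hxΩ)
      rw [norm_smul, Real.norm_of_nonneg (by linarith [hμ.1])] at this
      nlinarith [hμ.1, norm_nonneg x]
    rw [S.eq_zero _ h1, S.eq_zero _ h2, sub_zero, abs_zero]
    exact hδ

end IsDirichletSolution

/-! ### Pohozaev's inequality -/

/-- First-order Taylor expansion of `F`, uniform on `[0, B]` by uniform continuity of `f`. It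
replaces convexity of `F`, which is not assumed. -/
lemma exists_primitive_bound {f F : ℝ → ℝ} (hf : Continuous f) (hF : ∀ s, HasDerivAt F (f s) s)
    (B : ℝ) {ε : ℝ} (hε : 0 < ε) :
    ∃ δ > 0, ∀ a ∈ Icc 0 B, ∀ b ∈ Icc 0 B, |b - a| < δ →
      f a * (a - b) ≤ F a - F b + ε * |b - a| := by
  have huc := isCompact_Icc.uniformContinuousOn_of_continuous (hf.continuousOn (s := Icc 0 B))
  obtain ⟨δ, hδ, hu⟩ := Metric.uniformContinuousOn_iff.1 huc ε hε
  refine ⟨δ, hδ, fun a ha b hb hab => ?_⟩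
  have hbd : ∀ t ∈ uIcc a b, ‖f t - f a‖ ≤ ε := fun t ht => by
    rw [← dist_eq_norm]
    refine (hu t (uIcc_subset_Icc ha hb ht) a ha ?_).le
    rw [Real.dist_eq]
    exact (abs_sub_left_of_mem_uIcc ht).trans_lt (by rwa [abs_sub_comm] at hab ⊢)
  have hd : ∀ t ∈ uIcc a b, HasDerivWithinAt (fun t => F t - f a * t) (f t - f a) (uIcc a b) t :=
    fun t _ => by
      have := (hF t).sub ((hasDerivAt_id t).const_mul (f a))
      rw [mul_one] at this
      exact this.hasDerivWithinAt
  have := (convex_uIcc a b).norm_image_sub_le_of_norm_hasDerivWithin_le hd hbd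
    left_mem_uIcc right_mem_uIcc
  rw [Real.norm_eq_abs, Real.norm_eq_abs] at this
  have h2 := abs_le.1 this
  nlinarith [h2.1]

/-- **Pohozaev inequality** in a quantitatively starshaped domain. -/
lemma IsDirichletSolution.pohozaev {Ω : Set E3} {v : E3 → ℝ} {f F : ℝ → ℝ}
    (S : IsDirichletSolution Ω (fun x => f (v x)) v) (h0Ω : (0 : E3) ∈ Ω) {c : ℝ} (hc : 0 < c)
    (hstar : IsQuantStarshaped Ω c) (hf : Continuous f) (hF : ∀ s, HasDerivAt F (f s) s)
    (hF0 : F 0 = 0) :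
    c ^ 2 / (27 * volume.real Ω) * (∫ x, f (v x)) ^ 2 ≤
      6 * (∫ x, F (v x)) - ∫ x, f (v x) * v x := by
  have hvol : 0 < volume.real Ω :=
    ENNReal.toReal_pos (S.isOpen.measure_pos volume ⟨0, h0Ω⟩).ne' S.isBounded.measure_lt_top.ne
  have hFc : Continuous F := continuous_iff_continuousAt.2 fun s => (hF s).continuousAt
  have hFv : Continuous fun x => F (v x) := hFc.comp S.continuous
  have hFvs : HasCompactSupport fun x => F (v x) := S.hasCompactSupport.comp_left hF0
  have hFi : Integrable fun x => F (v x) := hFv.integrable_of_hasCompactSupport hFvs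
  obtain ⟨B, hB⟩ := S.hasCompactSupport.exists_bound_of_continuous S.continuous
  have hvB : ∀ x, v x ∈ Icc 0 B := fun x => ⟨S.nonneg x, (le_abs_self _).trans (hB x)⟩
  obtain ⟨K, hK0, hK⟩ := S.exists_integral_abs_comp_smul_sub_le
  have hδ : ∀ μ : ℝ, 1 < μ → 0 < c * (1 - μ⁻¹) := fun μ hμ =>
    mul_pos hc (by linarith [inv_lt_one_of_one_lt₀ hμ])
  have hcut : ∀ μ : ℝ, ∃ η : E3 → ℝ, 1 < μ → ContDiff ℝ 1 η ∧ (∀ x, |η x| ≤ 1) ∧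
      (∀ x ∈ dilate Ω μ, η x = 1) ∧ tsupport η ⊆ Ω ∧
      ∀ x, ‖gradient η x‖ ≤ 3 / (c * (1 - μ⁻¹)) := fun μ => by
    by_cases hμ : 1 < μ
    · obtain ⟨η, h1, h2, h3, h4, h5⟩ := exists_cutoff (A := dilate Ω μ)
        ⟨0, by simpa [dilate] using h0Ω⟩ (hδ μ hμ)
      exact ⟨η, fun _ => ⟨h1, h2, h3, h4.trans (hstar μ hμ), h5⟩⟩
    · exact ⟨0, fun h => absurd h hμ⟩
  choose η hη using hcut
  have hlimη : Tendsto (fun μ => ∫ x, f (v x) * η μ x) (𝓝[>] 1) (𝓝 (∫ x, f (v x))) := by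
    refine tendsto_integral_filter_of_dominated_convergence (fun x => |f (v x)|) ?_ ?_
      (S.continuous_rhs.abs.integrable_of_hasCompactSupport S.hasCompactSupport_rhs.abs) ?_
    · filter_upwards [self_mem_nhdsWithin] with μ hμ
      exact (S.continuous_rhs.mul (hη μ hμ).1.continuous).aestronglyMeasurable
    · filter_upwards [self_mem_nhdsWithin] with μ hμ
      refine Eventually.of_forall fun x => ?_
      rw [norm_mul, Real.norm_eq_abs, Real.norm_eq_abs]
      exact mul_le_of_le_one_right (abs_nonneg _) ((hη μ hμ).2.1 x)
    · refine Eventually.of_forall fun x => tendsto_const_nhds.congr' ?_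
      by_cases hx : x ∈ Ω
      · have hopen : ∀ᶠ μ : ℝ in 𝓝[>] 1, μ • x ∈ Ω := by
          have hcx : ContinuousAt (fun μ : ℝ => μ • x) 1 := by fun_prop
          exact nhdsWithin_le_nhds (hcx.eventually
            (by simpa using S.isOpen.mem_nhds hx))
        filter_upwards [hopen, self_mem_nhdsWithin] with μ hμx hμ
        rw [(hη μ hμ).2.2.1 x hμx, mul_one]
      · refine Eventually.of_forall fun μ => ?_
        have := S.rhs_eq_zero x hx
        simp only [this, zero_mul]
  refine le_of_forall_pos_le_add fun ε' hε' => ?_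
  obtain ⟨ε, hε, hεK⟩ : ∃ ε > 0, 2 * ε * K ≤ ε' := by
    refine ⟨ε' / (2 * (K + 1)), by positivity, ?_⟩
    rw [show 2 * (ε' / (2 * (K + 1))) * K = ε' * (K / (K + 1)) by field_simp]
    exact mul_le_of_le_one_right hε'.le ((div_le_one (by positivity)).2 (by linarith))
  obtain ⟨δ, hδpos, hδF⟩ := exists_primitive_bound hf hF B hε
  have hinv : Tendsto (fun μ : ℝ => μ⁻¹) (𝓝[>] 1) (𝓝 1) := by
    have : ContinuousAt (fun μ : ℝ => μ⁻¹) 1 := continuousAt_inv₀ one_ne_zero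
    simpa using this.tendsto.mono_left nhdsWithin_le_nhds
  have hid : Tendsto (fun μ : ℝ => μ) (𝓝[>] 1) (𝓝 1) :=
    tendsto_id.mono_left nhdsWithin_le_nhds
  -- The two sides of the inequality at fixed `μ`, already divided by `1 - μ⁻¹`. The coefficient 6
  -- is the limit of `2 (1 - μ⁻³) / (1 - μ⁻¹)`, and the `ε` term is the Taylor error.
  have hl : Tendsto (fun μ => c ^ 2 / (27 * volume.real Ω) * (∫ x, f (v x) * η μ x) ^ 2) (𝓝[>] 1)
      (𝓝 (c ^ 2 / (27 * volume.real Ω) * (∫ x, f (v x)) ^ 2)) := (hlimη.pow 2).const_mul _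
  have hr : Tendsto (fun μ : ℝ => 2 * (1 + μ⁻¹ + μ⁻¹ ^ 2) * (∫ x, F (v x)) -
      (∫ x, f (v x) * v x) + 2 * ε * K * μ) (𝓝[>] 1)
      (𝓝 (2 * (1 + 1 + 1 ^ 2) * (∫ x, F (v x)) - (∫ x, f (v x) * v x) + 2 * ε * K * 1)) :=
    ((((((hinv.const_add 1).add (hinv.pow 2)).const_mul 2).mul_const _).sub_const _).add
      (hid.const_mul _))
  have hle := le_of_tendsto_of_tendsto hl hr ?_
  · linarith
  filter_upwards [self_mem_nhdsWithin, S.eventually_abs_comp_smul_sub_lt hδpos] with μ hμ hclose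
  have hμ1 : 1 < μ := hμ
  have hμ0 : 0 < μ := by linarith
  obtain ⟨g1, g2, g3, g4, g5⟩ := hη μ hμ
  have hsub := hstar.dilate_subset hc hμ1
  have hflux := S.flux_sq_le g1 g4 g3 g5
  have hlay := S.energy_layer_le hμ1 hsub
  rw [measureReal_diff_dilate S.isOpen S.isBounded hμ0 hsub] at hflux
  have hvμ : Continuous fun x => v (μ • x) := S.continuous.comp (continuous_const_smul μ)
  have hvc : HasCompactSupport fun x => v (μ • x) := S.hasCompactSupport.comp_smul hμ0.ne'
  have hFμi : Integrable fun x => F (v (μ • x)) := hFi.comp_smul hμ0.ne'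
  have habs : Integrable fun x => |v (μ • x) - v x| :=
    ((hvμ.integrable_of_hasCompactSupport hvc).sub
      (S.continuous.integrable_of_hasCompactSupport S.hasCompactSupport)).abs
  -- Taylor expansion turns the increment of `v` into that of `F ∘ v`, whose integral is known
  -- exactly by scaling.
  have hdiff : (∫ x, f (v x) * v x) - ∫ x, f (v x) * v (μ • x) ≤
      (1 - μ⁻¹ ^ 3) * (∫ x, F (v x)) + ε * (K * (μ - 1)) := by
    have hFμ : ∫ x, F (v (μ • x)) = μ⁻¹ ^ 3 * ∫ x, F (v x) := by
      rw [Measure.integral_comp_smul volume (fun y => F (v y)), finrank_euclideanSpace_fin,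
        abs_of_pos (by positivity), smul_eq_mul, inv_pow]
    have I1 : Integrable fun x => F (v x) - F (v (μ • x)) := hFi.sub hFμi
    calc (∫ x, f (v x) * v x) - ∫ x, f (v x) * v (μ • x)
        = ∫ x, (f (v x) * v x - f (v x) * v (μ • x)) :=
          (integral_sub (S.integrable_rhs_mul S.continuous) (S.integrable_rhs_mul hvμ)).symm
      _ ≤ ∫ x, (F (v x) - F (v (μ • x)) + ε * |v (μ • x) - v x|) := by
          refine integral_mono ((S.integrable_rhs_mul S.continuous).sub (S.integrable_rhs_mul hvμ))
            (I1.add (habs.const_mul ε)) fun x => ?_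
          have := hδF (v x) (hvB x) (v (μ • x)) (hvB _) (hclose x)
          simp only
          linarith
      _ = (1 - μ⁻¹ ^ 3) * (∫ x, F (v x)) + ε * ∫ x, |v (μ • x) - v x| := by
          rw [integral_add I1 (habs.const_mul ε), integral_sub hFi hFμi, hFμ, integral_const_mul]
          ring
      _ ≤ _ := by
          have := hK μ hμ1.le
          gcongr
  set s := μ⁻¹ with hs
  have hs1 : s < 1 := inv_lt_one_of_one_lt₀ hμ1
  have hs0 : 0 < s := by positivity
  have hμs : μ - 1 = μ * (1 - s) := by rw [hs]; field_simp
  rw [hμs] at hdiff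
  set a := ∫ x, f (v x) * η μ x
  set E := ∫ x, f (v x) * v x
  set Φ := ∫ x, F (v x)
  set V := volume.real Ω
  set J := ∫ x in Ω \ dilate Ω μ, ‖gradient v x‖ ^ 2
  have hJ0 : 0 ≤ J := integral_nonneg fun x => sq_nonneg _
  have hsq : c ^ 2 / (27 * V) * a ^ 2 * (1 - s) ≤ J := by
    have h1s : 0 < 1 - s := by linarith
    -- The 27 is `3²` from the gradient of the cutoff times 3 from `1 - s³ ≤ 3 (1 - s)`.
    have hb : (3 / (c * (1 - s))) ^ 2 * ((1 - s ^ 3) * V) ≤ 27 * V / (c ^ 2 * (1 - s)) := by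
      rw [div_pow, div_mul_eq_mul_div, div_le_div_iff₀ (by positivity) (by positivity)]
      have : 1 - s ^ 3 ≤ 3 * (1 - s) := by nlinarith [mul_pos hs0 h1s]
      have h3 : 0 ≤ 9 * V * (c ^ 2 * (1 - s)) := by positivity
      nlinarith [mul_le_mul_of_nonneg_left this h3]
    have h4 := hflux.trans (mul_le_mul_of_nonneg_right hb hJ0)
    have h5 : 0 < c ^ 2 * (1 - s) / (27 * V) := by positivity
    calc c ^ 2 / (27 * V) * a ^ 2 * (1 - s) = c ^ 2 * (1 - s) / (27 * V) * a ^ 2 := by ring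
      _ ≤ c ^ 2 * (1 - s) / (27 * V) * (27 * V / (c ^ 2 * (1 - s)) * J) := by gcongr
      _ = J := by field_simp
  have h1s : 0 < 1 - s := by linarith
  refine le_of_mul_le_mul_right ?_ h1s
  -- Here `hlay` reads `J ≤ 2 (E - ∫ h v(μ x)) - (1 - s) E`; insert `hdiff` above and `hsq` below.
  nlinarith

/-! ### Sobolev's inequality and test functions for integrable data -/

lemma HasCompactSupport.fun_pow {w : E3 → ℝ} (hc : HasCompactSupport w) {k : ℕ} (hk : k ≠ 0) :
    HasCompactSupport fun x => w x ^ k :=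
  HasCompactSupport.intro hc fun x hx => by
    rw [image_eq_zero_of_notMem_tsupport hx, zero_pow hk]

lemma integrable_pow_of_hasCompactSupport {w : E3 → ℝ} (hw : Continuous w)
    (hc : HasCompactSupport w) {k : ℕ} (hk : k ≠ 0) : Integrable fun x => w x ^ k := by
  have hp : Continuous fun x => w x ^ k := hw.pow k
  exact hp.integrable_of_hasCompactSupport (hc.fun_pow hk)

/-- Sobolev's inequality in dimension three. -/
lemma exists_sobolev_const : ∃ C : ℝ, 0 ≤ C ∧ ∀ w : E3 → ℝ, ContDiff ℝ 1 w → HasCompactSupport w →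
    ∫ x, w x ^ 6 ≤ C * (∫ x, ‖gradient w x‖ ^ 2) ^ 3 := by
  let K : NNReal := eLpNormLESNormFDerivOfEqInnerConst (volume : Measure E3) (2 : NNReal)
  refine ⟨(K : ℝ) ^ 6, by positivity, fun w hw hc => ?_⟩
  have hs := eLpNorm_le_eLpNorm_fderiv_of_eq_inner (volume : Measure E3) hw hc
    (p := 2) (p' := 6) (by norm_num) (by simp) (by norm_num)
  have m1 : MemLp w ((6 : NNReal) : ENNReal) volume := hw.continuous.memLp_of_hasCompactSupport hc
  have m2 : MemLp (fderiv ℝ w) ((2 : NNReal) : ENNReal) volume :=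
    (hw.continuous_fderiv one_ne_zero).memLp_of_hasCompactSupport (hc.fderiv ℝ)
  rw [m1.eLpNorm_eq_integral_rpow_norm (by norm_num) (by simp),
    m2.eLpNorm_eq_integral_rpow_norm (by norm_num) (by simp),
    ← ENNReal.ofReal_coe_nnreal (p := eLpNormLESNormFDerivOfEqInnerConst _ _),
    ← ENNReal.ofReal_mul (by positivity), ENNReal.ofReal_le_ofReal_iff (by positivity)] at hs
  simp only [ENNReal.coe_toReal, NNReal.coe_ofNat, Real.rpow_ofNat] at hs
  have e1 : ∀ x, ‖w x‖ ^ 6 = w x ^ 6 := fun x => by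
    rw [Real.norm_eq_abs, Even.pow_abs (by decide)]
  simp_rw [e1, ← norm_gradient] at hs
  have hA : 0 ≤ ∫ x, w x ^ 6 := integral_nonneg fun x => by positivity
  have hB : 0 ≤ ∫ x, ‖gradient w x‖ ^ 2 := integral_nonneg fun x => by positivity
  have h6 := pow_le_pow_left₀ (by positivity) hs 6
  rw [mul_pow, ← Real.rpow_natCast, ← Real.rpow_mul hA,
    ← Real.rpow_natCast ((∫ x, ‖gradient w x‖ ^ 2) ^ _), ← Real.rpow_mul hB] at h6
  norm_num at h6
  exact h6

/-- Test the equation with `ψ ∘ v` and apply Sobolev's inequality to `Φ ∘ v`. The condition `Φ'² ≤ A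
ψ'` compares the two energies pointwise. -/
lemma IsDirichletSolution.integral_comp_pow_six_le {Ω : Set E3} {h v : E3 → ℝ}
    (S : IsDirichletSolution Ω h v) {C : ℝ} (hC0 : 0 ≤ C)
    (hC : ∀ w : E3 → ℝ, ContDiff ℝ 1 w → HasCompactSupport w →
      ∫ x, w x ^ 6 ≤ C * (∫ x, ‖gradient w x‖ ^ 2) ^ 3)
    {ψ Φ : ℝ → ℝ} (hψ : ContDiff ℝ 1 ψ) (hΦ : ContDiff ℝ 1 Φ) {ε : ℝ} (hε : 0 < ε)
    (hψ0 : ∀ s ≤ ε, ψ s = 0) (hΦ0 : ∀ s ≤ ε, Φ s = 0) {A : ℝ}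
    (hA : ∀ s, deriv Φ s ^ 2 ≤ A * deriv ψ s) :
    ∫ x, Φ (v x) ^ 6 ≤ C * (A * ∫ x, h x * ψ (v x)) ^ 3 := by
  obtain ⟨a1, a2, a3, a4⟩ := S.comp_truncation hψ hε hψ0
  obtain ⟨b1, b2, b3, b4⟩ := S.comp_truncation hΦ hε hΦ0
  refine (hC _ b1 b2).trans ?_
  have hle : ∫ x, ‖gradient (fun y => Φ (v y)) x‖ ^ 2 ≤ A * ∫ x, h x * ψ (v x) := by
    rw [← S.weak_form a1 a2 a3, ← integral_const_mul]
    refine integral_mono (integrable_norm_gradient_sq b1 b2) (Integrable.const_mul ?_ A) fun x => ?_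
    · refine integrable_of_continuousOn_isCompact a2 ?_ fun x hx => by
        rw [gradient_eq_zero_of_notMem_tsupport hx, inner_zero_right]
      exact ((S.contDiffOn.continuousOn_gradient S.isOpen).mono a3).inner
        a1.continuous_gradient.continuousOn
    · simp only
      rw [a4, b4, inner_smul_right, real_inner_self_eq_norm_sq, norm_smul, mul_pow,
        Real.norm_eq_abs, sq_abs, ← mul_assoc]
      exact mul_le_mul_of_nonneg_right (hA _) (sq_nonneg _)
  have h0 : 0 ≤ ∫ x, ‖gradient (fun y => Φ (v y)) x‖ ^ 2 := integral_nonneg fun x => sq_nonneg _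
  gcongr

/-- The function `s ↦ (1 + s / m) ^ (1 / 3) - 1`. -/
noncomputable def cubeRootShift (m s : ℝ) : ℝ := (1 + s / m) ^ (1 / 3 : ℝ) - 1

lemma one_add_cubeRootShift_pow {m s : ℝ} (hm : 0 < m) (hs : 0 ≤ s) :
    (1 + cubeRootShift m s) ^ 3 = 1 + s / m := by
  have : 0 ≤ 1 + s / m := by positivity
  rw [cubeRootShift, add_sub_cancel, ← Real.rpow_natCast, ← Real.rpow_mul this]
  norm_num

lemma cubeRootShift_nonneg {m s : ℝ} (hm : 0 < m) (hs : 0 ≤ s) : 0 ≤ cubeRootShift m s := by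
  have : (1 : ℝ) ≤ (1 + s / m) ^ (1 / 3 : ℝ) :=
    Real.one_le_rpow (by linarith [div_nonneg hs hm.le]) (by norm_num)
  rw [cubeRootShift]
  linarith

lemma cubeRootShift_zero (m : ℝ) : cubeRootShift m 0 = 0 := by simp [cubeRootShift]

lemma cubeRootShift_mono {m s t : ℝ} (hm : 0 < m) (hs : 0 ≤ s) (hst : s ≤ t) :
    cubeRootShift m s ≤ cubeRootShift m t := by
  have : 0 ≤ 1 + s / m := by positivity
  unfold cubeRootShift
  gcongr

lemma contDiffAt_cubeRootShift {m s : ℝ} (hm : 0 < m) (hs : 0 ≤ s) :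
    ContDiffAt ℝ 1 (cubeRootShift m) s := by
  have : 0 < 1 + s / m := by positivity
  exact ((contDiffAt_const.add (contDiffAt_id.div_const m)).rpow_const_of_ne this.ne').sub
    contDiffAt_const

lemma hasDerivAt_cubeRootShift {m s : ℝ} (hm : 0 < m) (hs : 0 ≤ s) :
    HasDerivAt (cubeRootShift m) (1 / (3 * m * (1 + cubeRootShift m s) ^ 2)) s := by
  have hpos : 0 < 1 + s / m := by positivity
  have h1 : HasDerivAt (fun s : ℝ => 1 + s / m) (1 / m) s :=
    ((hasDerivAt_id s).div_const m).const_add 1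
  have h2 := (h1.rpow_const (p := 1 / 3) (Or.inl hpos.ne')).sub_const 1
  refine h2.congr_deriv ?_
  have h3 : (1 + s / m) ^ (1 / 3 - 1 : ℝ) = ((1 + cubeRootShift m s) ^ 2)⁻¹ := by
    rw [cubeRootShift, add_sub_cancel, ← Real.rpow_natCast, ← Real.rpow_mul hpos.le,
      ← Real.rpow_neg hpos.le]
    norm_num
  rw [h3]
  have : 0 < 1 + cubeRootShift m s := by linarith [cubeRootShift_nonneg hm hs]
  field_simp

/-- Saturated quadratic profile. -/
noncomputable def saturatedQuad (T y : ℝ) : ℝ := (y ^ 2 + 2 * y) / (1 + y / T)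

lemma saturatedQuad_nonneg {T y : ℝ} (hT : 0 < T) (hy : 0 ≤ y) : 0 ≤ saturatedQuad T y := by
  unfold saturatedQuad
  positivity

lemma saturatedQuad_le {T y : ℝ} (hT : 0 < T) (hy : 0 ≤ y) : saturatedQuad T y ≤ y ^ 2 + 2 * y :=
  div_le_self (by positivity) (by linarith [div_nonneg hy hT.le])

lemma hasDerivAt_div_one_add {T y : ℝ} (hT : 0 < T) (hy : 0 ≤ y) :
    HasDerivAt (fun y : ℝ => y / (1 + y / T)) (1 / (1 + y / T) ^ 2) y := by
  have hpos : 0 < 1 + y / T := by positivity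
  have h1 : HasDerivAt (fun y : ℝ => 1 + y / T) (1 / T) y :=
    ((hasDerivAt_id y).div_const T).const_add 1
  refine ((hasDerivAt_id y).div h1 hpos.ne').congr_deriv ?_
  simp only [id]
  congr 1
  ring

lemma exists_hasDerivAt_saturatedQuad {T y : ℝ} (hT : 0 < T) (hy : 0 ≤ y) :
    ∃ d, HasDerivAt (saturatedQuad T) d y ∧ d ^ 2 ≤ 4 * (1 + y) ^ 2 / (1 + y / T) ^ 2 := by
  have hpos : 0 < 1 + y / T := by positivity
  have h1 : HasDerivAt (fun y : ℝ => 1 + y / T) (1 / T) y :=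
    ((hasDerivAt_id y).div_const T).const_add 1
  have h2 : HasDerivAt (fun y : ℝ => y ^ 2 + 2 * y) (2 * y + 2) y := by
    refine ((hasDerivAt_pow 2 y).add ((hasDerivAt_id y).const_mul 2)).congr_deriv ?_
    norm_num
  refine ⟨_, h2.div h1 hpos.ne', ?_⟩
  rw [show 4 * (1 + y) ^ 2 / (1 + y / T) ^ 2 = (2 * (1 + y) / (1 + y / T)) ^ 2 by
    rw [div_pow]; ring]
  have hTy : (y ^ 2 + 2 * y) * (1 / T) = y / T * (y + 2) := by ring
  have hq : 0 ≤ y / T := by positivity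
  refine pow_le_pow_left₀ (div_nonneg ?_ (sq_nonneg _)) ?_ 2
  · rw [hTy]
    nlinarith [mul_nonneg hq hy]
  · rw [div_le_div_iff₀ (by positivity) hpos, hTy]
    nlinarith [mul_nonneg (mul_nonneg hq hpos.le) (by linarith : 0 ≤ y + 2)]

/-- `cubeRootShift` composed with the truncation. -/
noncomputable def truncRoot (m : ℝ) (n : ℕ) (s : ℝ) : ℝ := cubeRootShift m (trunc n s)

lemma truncRoot_nonneg {m : ℝ} (hm : 0 < m) (n : ℕ) (s : ℝ) : 0 ≤ truncRoot m n s :=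
  cubeRootShift_nonneg hm (trunc_nonneg n s)

lemma one_add_truncRoot_div_pos {m T : ℝ} (hm : 0 < m) (hT : 0 < T) (n : ℕ) (s : ℝ) :
    0 < 1 + truncRoot m n s / T := by
  have := div_nonneg (truncRoot_nonneg hm n s) hT.le
  positivity

lemma contDiff_truncRoot {m : ℝ} (hm : 0 < m) (n : ℕ) : ContDiff ℝ 1 (truncRoot m n) :=
  contDiff_iff_contDiffAt.2 fun s =>
    (contDiffAt_cubeRootShift hm (trunc_nonneg n s)).comp s (contDiff_trunc n).contDiffAt

lemma hasDerivAt_truncRoot {m : ℝ} (hm : 0 < m) (n : ℕ) (s : ℝ) :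
    HasDerivAt (truncRoot m n)
      (1 / (3 * m * (1 + truncRoot m n s) ^ 2) * truncSlope n s) s :=
  (hasDerivAt_cubeRootShift hm (trunc_nonneg n s)).comp s (hasDerivAt_trunc n s)

/-- The substitution `y = (1 + v/m)^(1/3) - 1` has `dy/dv = 1 / (3m (1 + y)²)`, which cancels the
factor `(1 + y)²` coming from the square of the derivative of `saturatedQuad`. The profile `y / (1 +
y/T)` used for testing is bounded by `T`. -/
lemma deriv_saturatedQuad_truncRoot_sq_le {m T : ℝ} (hm : 0 < m) (hT : 0 < T) (n : ℕ) (s : ℝ) :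
    deriv (fun s => saturatedQuad T (truncRoot m n s)) s ^ 2 ≤
      4 / (3 * m) * deriv (fun s => truncRoot m n s / (1 + truncRoot m n s / T)) s := by
  have hz := truncRoot_nonneg hm n s
  have hzT := one_add_truncRoot_div_pos hm hT n s
  obtain ⟨d, hd, hd2⟩ := exists_hasDerivAt_saturatedQuad hT hz
  have e1 := (hd.comp s (hasDerivAt_truncRoot hm n s)).deriv
  have e2 := ((hasDerivAt_div_one_add hT hz).comp s (hasDerivAt_truncRoot hm n s)).deriv
  simp only [Function.comp_def] at e1 e2
  rw [e1, e2]
  have hk0 : 0 ≤ truncSlope n s := truncSlope_nonneg n s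
  have hk1 : truncSlope n s ≤ 1 := truncSlope_le_one n s
  generalize truncSlope n s = k at *
  generalize truncRoot m n s = z at *
  calc (d * (1 / (3 * m * (1 + z) ^ 2) * k)) ^ 2
      = d ^ 2 * (1 / (3 * m * (1 + z) ^ 2) ^ 2) * (k * k) := by
        generalize 3 * m * (1 + z) ^ 2 = X
        ring
    _ ≤ 4 * (1 + z) ^ 2 / (1 + z / T) ^ 2 * (1 / (3 * m * (1 + z) ^ 2) ^ 2) * (1 * k) := by
        gcongr
    _ = 4 / (3 * m) * (1 / (1 + z / T) ^ 2 * (1 / (3 * m * (1 + z) ^ 2) * k)) := by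
        field_simp

namespace IsDirichletSolution

variable {Ω : Set E3} {h v : E3 → ℝ}

lemma continuous_saturatedQuad_cubeRootShift (S : IsDirichletSolution Ω h v) {m T : ℝ}
    (hm : 0 < m) (hT : 0 < T) :
    Continuous (fun x => cubeRootShift m (v x)) ∧
    Continuous (fun x => saturatedQuad T (cubeRootShift m (v x))) ∧
    HasCompactSupport (fun x => saturatedQuad T (cubeRootShift m (v x))) := by
  have hYc : Continuous fun x => cubeRootShift m (v x) := continuous_iff_continuousAt.2 fun x =>
    (contDiffAt_cubeRootShift hm (S.nonneg x)).continuousAt.comp S.continuous.continuousAt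
  refine ⟨hYc, continuous_iff_continuousAt.2 fun x => ?_,
    HasCompactSupport.intro S.hasCompactSupport fun x hx => by
      rw [image_eq_zero_of_notMem_tsupport hx, cubeRootShift_zero]
      simp [saturatedQuad]⟩
  obtain ⟨d, hd, -⟩ := exists_hasDerivAt_saturatedQuad hT (cubeRootShift_nonneg hm (S.nonneg x))
  exact hd.continuousAt.comp (f := fun x => cubeRootShift m (v x)) hYc.continuousAt

/-- The test function is at most `T`, so only the `L¹` norm of `h` enters. The free parameters serve
two purposes: `m = M`, `T = 1` yields the `L²` bound, and `m = 1`, `T = M^(-1/3)` yields the `L⁴`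
bound. -/
lemma integral_saturatedQuad_trunc_pow_six_le (S : IsDirichletSolution Ω h v) {C : ℝ} (hC0 : 0 ≤ C)
    (hC : ∀ w : E3 → ℝ, ContDiff ℝ 1 w → HasCompactSupport w →
      ∫ x, w x ^ 6 ≤ C * (∫ x, ‖gradient w x‖ ^ 2) ^ 3)
    (hh : ∀ x, 0 ≤ h x) {m T : ℝ} (hm : 0 < m) (hT : 0 < T) (n : ℕ) :
    ∫ x, saturatedQuad T (cubeRootShift m (trunc n (v x))) ^ 6 ≤
      C * (4 / (3 * m) * (T * ∫ x, h x)) ^ 3 := by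
  have hy0 : ∀ s, 0 ≤ truncRoot m n s := truncRoot_nonneg hm n
  have hyT := one_add_truncRoot_div_pos hm hT n
  have hyc := contDiff_truncRoot hm n
  have hψc : ContDiff ℝ 1 fun s => truncRoot m n s / (1 + truncRoot m n s / T) :=
    hyc.div (contDiff_const.add (hyc.div_const T)) fun s => (hyT s).ne'
  have hΦc : ContDiff ℝ 1 fun s => saturatedQuad T (truncRoot m n s) :=
    ((hyc.pow 2).add (contDiff_const.mul hyc)).div
      (contDiff_const.add (hyc.div_const T)) fun s => (hyT s).ne'
  have hyz : ∀ s ≤ ((n : ℝ) + 1)⁻¹, truncRoot m n s = 0 := fun s hs => by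
    simp only [truncRoot, trunc_eq_zero hs, cubeRootShift_zero]
  have key := S.integral_comp_pow_six_le hC0 hC hψc hΦc (ε := ((n : ℝ) + 1)⁻¹) (by positivity)
    (fun s hs => by simp [hyz s hs]) (fun s hs => by simp [hyz s hs, saturatedQuad])
    (deriv_saturatedQuad_truncRoot_sq_le hm hT n)
  refine key.trans ?_
  have hψle : ∀ x, truncRoot m n (v x) / (1 + truncRoot m n (v x) / T) ≤ T := fun x => by
    rw [div_le_iff₀ (hyT _), mul_add, mul_div_cancel₀ _ hT.ne']
    linarith
  have hψ0 : ∀ x, 0 ≤ truncRoot m n (v x) / (1 + truncRoot m n (v x) / T) := fun x =>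
    div_nonneg (hy0 _) (hyT _).le
  have hle : ∫ x, h x * (truncRoot m n (v x) / (1 + truncRoot m n (v x) / T)) ≤ T * ∫ x, h x := by
    rw [← integral_const_mul]
    refine integral_mono (S.integrable_rhs_mul (hψc.continuous.comp S.continuous))
      ((S.continuous_rhs.integrable_of_hasCompactSupport S.hasCompactSupport_rhs).const_mul T)
      fun x => ?_
    simp only
    rw [mul_comm T]
    exact mul_le_mul_of_nonneg_left (hψle x) (hh x)
  have h0 : 0 ≤ ∫ x, h x * (truncRoot m n (v x) / (1 + truncRoot m n (v x) / T)) :=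
    integral_nonneg fun x => mul_nonneg (hh x) (hψ0 x)
  gcongr

lemma integral_saturatedQuad_pow_six_le (S : IsDirichletSolution Ω h v) {C : ℝ} (hC0 : 0 ≤ C)
    (hC : ∀ w : E3 → ℝ, ContDiff ℝ 1 w → HasCompactSupport w →
      ∫ x, w x ^ 6 ≤ C * (∫ x, ‖gradient w x‖ ^ 2) ^ 3)
    (hh : ∀ x, 0 ≤ h x) {m T : ℝ} (hm : 0 < m) (hT : 0 < T) :
    ∫ x, saturatedQuad T (cubeRootShift m (v x)) ^ 6 ≤
      C * (4 / (3 * m) * (T * ∫ x, h x)) ^ 3 := by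
  obtain ⟨hYc, -⟩ := S.continuous_saturatedQuad_cubeRootShift hm hT
  have hlim : Tendsto (fun n => ∫ x, saturatedQuad T (cubeRootShift m (trunc n (v x))) ^ 6) atTop
      (𝓝 (∫ x, saturatedQuad T (cubeRootShift m (v x)) ^ 6)) := by
    refine tendsto_integral_of_dominated_convergence
      (fun x => (cubeRootShift m (v x) ^ 2 + 2 * cubeRootShift m (v x)) ^ 6) (fun n => ?_) ?_
      (fun n => Eventually.of_forall fun x => ?_) (Eventually.of_forall fun x => ?_)
    · have hyn : Continuous fun x => saturatedQuad T (truncRoot m n (v x)) := by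
        refine continuous_iff_continuousAt.2 fun x => ?_
        obtain ⟨d, hd, -⟩ := exists_hasDerivAt_saturatedQuad hT (truncRoot_nonneg hm n (v x))
        exact hd.continuousAt.comp (f := fun x => truncRoot m n (v x))
          ((contDiff_truncRoot hm n).continuous.comp S.continuous).continuousAt
      exact (hyn.pow 6).aestronglyMeasurable
    · refine integrable_pow_of_hasCompactSupport (by fun_prop) (HasCompactSupport.intro
        S.hasCompactSupport fun x hx => ?_) (by norm_num)
      rw [image_eq_zero_of_notMem_tsupport hx, cubeRootShift_zero]
      norm_num
    · have hy0 := cubeRootShift_nonneg hm (trunc_nonneg n (v x))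
      have hq := saturatedQuad_nonneg hT hy0
      rw [Real.norm_of_nonneg (pow_nonneg hq 6)]
      have hmono := cubeRootShift_mono hm (trunc_nonneg n _) (trunc_le (n := n) (S.nonneg x))
      refine pow_le_pow_left₀ hq ((saturatedQuad_le hT hy0).trans ?_) 6
      gcongr
    · have hy : Tendsto (fun n => cubeRootShift m (trunc n (v x))) atTop
          (𝓝 (cubeRootShift m (v x))) :=
        (contDiffAt_cubeRootShift hm (S.nonneg x)).continuousAt.tendsto.comp
          (tendsto_trunc (S.nonneg x))
      obtain ⟨d, hd, -⟩ := exists_hasDerivAt_saturatedQuad hT (cubeRootShift_nonneg hm (S.nonneg x))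
      exact (hd.continuousAt.tendsto.comp hy).pow 6
  exact le_of_tendsto' hlim fun n => S.integral_saturatedQuad_trunc_pow_six_le hC0 hC hh hm hT n

/-- If the integral vanished, the estimate with `m = T = 1` would force `v = 0`; this takes the
place of a uniqueness theorem for harmonic functions. -/
lemma integral_rhs_pos (S : IsDirichletSolution Ω h v) (h0Ω : (0 : E3) ∈ Ω)
    (hh : ∀ x, 0 ≤ h x) : 0 < ∫ x, h x := by
  obtain ⟨C, hC0, hC⟩ := exists_sobolev_const
  obtain ⟨-, h1, h2⟩ := S.continuous_saturatedQuad_cubeRootShift one_pos one_pos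
  have h3 := S.integral_saturatedQuad_pow_six_le hC0 hC hh one_pos one_pos
  refine (integral_nonneg hh).lt_of_ne' fun heq => ?_
  rw [heq] at h3
  have hy : 0 < cubeRootShift 1 (v 0) := by
    have h4 := one_add_cubeRootShift_pow one_pos (S.nonneg 0)
    refine (cubeRootShift_nonneg one_pos (S.nonneg 0)).lt_of_ne' fun h0 => ?_
    rw [h0] at h4
    linarith [S.pos 0 h0Ω]
  have h5 : Continuous fun x => saturatedQuad 1 (cubeRootShift 1 (v x)) ^ 6 := h1.pow 6
  have hpos := h5.integral_pos_of_hasCompactSupport_nonneg_nonzero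
    (μ := (volume : Measure E3)) (x := 0) (h2.fun_pow (by norm_num))
    (fun x => pow_nonneg
      (saturatedQuad_nonneg one_pos (cubeRootShift_nonneg one_pos (S.nonneg x))) 6)
    (by
      have : 0 < saturatedQuad 1 (cubeRootShift 1 (v 0)) := by
        unfold saturatedQuad
        positivity
      exact (pow_pos this 6).ne')
  norm_num at h3
  linarith

end IsDirichletSolution

/-! ### Bounds for the second and fourth powers by the flux -/

/-- The `L²` and `L⁴` norms of `v` are controlled by the `L¹` norm of `h`, provided that `h`
dominates `v⁵`. -/
lemma exists_integral_sq_add_pow_four_le (V : ℝ) (hV : 0 ≤ V) :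
    ∃ C : ℝ, 0 ≤ C ∧ ∀ (Ω : Set E3) (h v : E3 → ℝ), volume.real Ω = V → (0 : E3) ∈ Ω →
      IsDirichletSolution Ω h v → (∀ x, v x ^ 5 ≤ 2 * h x) →
      ∫ x, (v x ^ 2 + v x ^ 4) ≤ C * (∫ x, h x) ^ 2 := by
  obtain ⟨C, hC0, hC⟩ := exists_sobolev_const
  let C₂ : ℝ := 32 * (V + C * (64 / 27))
  have hC₂ : 0 ≤ C₂ := by positivity
  refine ⟨50 * C₂ + 7 ^ 4 * 64 * (C * (64 / 27)) + 2, by positivity, ?_⟩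
  intro Ω h v hΩV h0Ω S hv5
  have hv0 := S.nonneg
  have hh : ∀ x, 0 ≤ h x := fun x => by
    have := pow_nonneg (hv0 x) 5
    linarith [hv5 x]
  have hM := S.integral_rhs_pos h0Ω hh
  have hhi : Integrable h := S.continuous_rhs.integrable_of_hasCompactSupport S.hasCompactSupport_rhs
  set M := ∫ x, h x with hMdef
  have ipow : ∀ k : ℕ, k ≠ 0 → Integrable fun x => v x ^ k := fun k hk =>
    integrable_pow_of_hasCompactSupport S.continuous S.hasCompactSupport hk
  -- Measuring `v` in units of `M` makes the right-hand side of the estimate independent of `M`;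
  -- then `v² ≤ M² (1 + y)⁶` and `y ≤ saturatedQuad 1 y`.
  have hL2 : ∫ x, v x ^ 2 ≤ C₂ * M ^ 2 := by
    obtain ⟨-, h1, h2⟩ := S.continuous_saturatedQuad_cubeRootShift hM one_pos
    have h3 := S.integral_saturatedQuad_pow_six_le hC0 hC hh hM one_pos
    have i6 : Integrable fun x => saturatedQuad 1 (cubeRootShift M (v x)) ^ 6 :=
      integrable_pow_of_hasCompactSupport h1 h2 (by norm_num)
    rw [← hMdef, show 4 / (3 * M) * (1 * M) = 4 / 3 by field_simp] at h3
    have hpt : ∀ x, v x ^ 2 ≤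
        32 * M ^ 2 * (1 + saturatedQuad 1 (cubeRootShift M (v x)) ^ 6) := fun x => by
      have hy0 := cubeRootShift_nonneg hM (hv0 x)
      have hy3 := one_add_cubeRootShift_pow hM (hv0 x)
      set y := cubeRootShift M (v x)
      have hQ : y ≤ saturatedQuad 1 y := by
        rw [saturatedQuad, div_one, le_div_iff₀ (by positivity)]
        nlinarith
      have hvx : v x = M * ((1 + y) ^ 3 - 1) := by rw [hy3]; field_simp; ring
      have hvle : v x ≤ M * (1 + y) ^ 3 := by rw [hvx]; nlinarith
      have h32 : (1 + y) ^ 6 ≤ 32 * (1 + y ^ 6) := by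
        have := add_pow_le (zero_le_one' ℝ) hy0 6
        norm_num at this
        linarith
      calc v x ^ 2 ≤ (M * (1 + y) ^ 3) ^ 2 := pow_le_pow_left₀ (hv0 x) hvle 2
        _ = M ^ 2 * (1 + y) ^ 6 := by ring
        _ ≤ M ^ 2 * (32 * (1 + y ^ 6)) := by gcongr
        _ ≤ M ^ 2 * (32 * (1 + saturatedQuad 1 y ^ 6)) := by gcongr
        _ = _ := by ring
    have : Fact (volume Ω < ⊤) := ⟨S.isBounded.measure_lt_top⟩
    have i7 : IntegrableOn (fun x =>
        1 + saturatedQuad 1 (cubeRootShift M (v x)) ^ 6) Ω :=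
      (integrable_const 1).add i6.integrableOn
    rw [← setIntegral_eq_integral_of_forall_compl_eq_zero (s := Ω) fun x hx => by
      rw [S.eq_zero x hx, zero_pow two_ne_zero]]
    calc ∫ x in Ω, v x ^ 2
        ≤ ∫ x in Ω, 32 * M ^ 2 * (1 + saturatedQuad 1 (cubeRootShift M (v x)) ^ 6) :=
          setIntegral_mono_on (ipow 2 two_ne_zero).integrableOn
            (i7.const_mul _) S.isOpen.measurableSet fun x _ => hpt x
      _ = 32 * M ^ 2 * (V + ∫ x in Ω, saturatedQuad 1 (cubeRootShift M (v x)) ^ 6) := by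
          rw [integral_const_mul, integral_add (integrable_const 1) i6.integrableOn,
            setIntegral_const, smul_eq_mul, mul_one, hΩV]
      _ ≤ 32 * M ^ 2 * (V + ∫ x, saturatedQuad 1 (cubeRootShift M (v x)) ^ 6) := by
          gcongr ?_ * (V + ?_)
          exact setIntegral_le_integral i6 (Eventually.of_forall fun x =>
            Even.pow_nonneg (by decide) _)
      _ ≤ 32 * M ^ 2 * (V + C * (4 / 3) ^ 3) := by gcongr
      _ = C₂ * M ^ 2 := by simp only [C₂]; ring
  have hL4 : ∫ x, v x ^ 4 ≤ 49 * (C₂ * M ^ 2) + 7 ^ 4 * 64 * (C * (64 / 27) * M ^ 2) +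
      2 * M ^ 2 := by
    -- Chosen so that `(T M)³ = M²`, while `y = T` corresponds to `v` of order `T³ = 1/M`.
    let T : ℝ := M ^ (-(1 / 3) : ℝ)
    have hT : 0 < T := Real.rpow_pos_of_pos hM _
    have hT3 : T ^ 3 = M⁻¹ := by
      rw [← Real.rpow_natCast, ← Real.rpow_mul hM.le, ← Real.rpow_neg_one]
      norm_num
    obtain ⟨-, h1, h2⟩ := S.continuous_saturatedQuad_cubeRootShift one_pos hT
    have h3 := S.integral_saturatedQuad_pow_six_le hC0 hC hh one_pos hT
    have i6 : Integrable fun x => saturatedQuad T (cubeRootShift 1 (v x)) ^ 6 :=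
      integrable_pow_of_hasCompactSupport h1 h2 (by norm_num)
    have e3 : (4 / (3 * 1) * (T * M)) ^ 3 = 64 / 27 * M ^ 2 := by
      rw [mul_pow, mul_pow, hT3]
      field_simp
      norm_num
    rw [← hMdef, e3, ← mul_assoc] at h3
    have hpt : ∀ x, v x ^ 4 ≤ 49 * v x ^ 2 +
        7 ^ 4 * 64 * saturatedQuad T (cubeRootShift 1 (v x)) ^ 6 + M * (2 * h x) := fun x => by
      have hy0 := cubeRootShift_nonneg one_pos (hv0 x)
      have hy3 := one_add_cubeRootShift_pow one_pos (hv0 x)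
      set y := cubeRootShift 1 (v x)
      have hvx : v x = y ^ 3 + 3 * y ^ 2 + 3 * y := by linear_combination -hy3
      have hQ0 := saturatedQuad_nonneg hT hy0
      have t1 : 0 ≤ 49 * v x ^ 2 := by positivity
      have t2 : 0 ≤ 7 ^ 4 * 64 * saturatedQuad T y ^ 6 := by positivity
      have t3 : 0 ≤ M * (2 * h x) := mul_nonneg hM.le (mul_nonneg two_pos.le (hh x))
      -- Three ranges: for `y ≤ 1`, `v ≤ 1 + 3 + 3 = 7` and `v²` suffices; for `1 ≤ y ≤ T`, `v⁴ ≲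
      -- y¹²` and saturation costs a factor 2; for `y ≥ T`, `M v ≥ 1` and `v⁵ ≤ 2h` is used.
      rcases le_total y 1 with hy1 | hy1
      · have hv7 : v x ≤ 7 := by
          have a1 : y ^ 2 ≤ 1 := pow_le_one₀ hy0 hy1
          have a2 : y ^ 3 ≤ 1 := pow_le_one₀ hy0 hy1
          linarith
        have : v x ^ 2 ≤ 49 := by nlinarith [hv0 x]
        nlinarith [sq_nonneg (v x)]
      · rcases le_total y T with hyT | hyT
        · have hv7 : v x ≤ 7 * y ^ 3 := by
            have a1 : y ^ 2 ≤ y ^ 3 := pow_le_pow_right₀ hy1 (by norm_num)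
            have a2 : y ≤ y ^ 3 := le_self_pow₀ hy1 (by norm_num)
            linarith
          have hq : y ^ 2 ≤ 2 * saturatedQuad T y := by
            have h5 : y / T ≤ 1 := (div_le_one hT).2 hyT
            have h6 : 0 ≤ y / T := by positivity
            rw [saturatedQuad, mul_div_assoc', le_div_iff₀ (by positivity)]
            nlinarith [sq_nonneg y]
          have h12 : v x ^ 4 ≤ 7 ^ 4 * 64 * saturatedQuad T y ^ 6 := by
            calc v x ^ 4 ≤ (7 * y ^ 3) ^ 4 := pow_le_pow_left₀ (hv0 x) hv7 4
              _ = 7 ^ 4 * (y ^ 2) ^ 6 := by ring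
              _ ≤ 7 ^ 4 * (2 * saturatedQuad T y) ^ 6 := by gcongr
              _ = _ := by ring
          linarith
        · have hvT : M⁻¹ ≤ v x := by
            rw [← hT3]
            have := pow_le_pow_left₀ hT.le hyT 3
            have : 0 ≤ y ^ 2 := sq_nonneg y
            linarith
          have h1M : 1 ≤ M * v x := by
            rw [← inv_le_iff_one_le_mul₀' hM]
            exact hvT
          have : v x ^ 4 ≤ M * (2 * h x) := by
            calc v x ^ 4 ≤ (M * v x) * v x ^ 4 :=
                  le_mul_of_one_le_left (pow_nonneg (hv0 x) 4) h1M
              _ = M * v x ^ 5 := by ring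
              _ ≤ M * (2 * h x) := mul_le_mul_of_nonneg_left (hv5 x) hM.le
          linarith
    have j1 : Integrable fun x => 49 * v x ^ 2 := (ipow 2 two_ne_zero).const_mul 49
    have j2 : Integrable fun x =>
        7 ^ 4 * 64 * saturatedQuad T (cubeRootShift 1 (v x)) ^ 6 := i6.const_mul _
    have j3 : Integrable fun x => M * (2 * h x) := (hhi.const_mul 2).const_mul M
    have j12 : Integrable fun x => 49 * v x ^ 2 +
        7 ^ 4 * 64 * saturatedQuad T (cubeRootShift 1 (v x)) ^ 6 := j1.add j2
    have hint := integral_mono (ipow 4 (by norm_num)) (j12.add j3) hpt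
    have hsum := integral_add j12 j3
    simp only [Pi.add_apply] at hint
    rw [hsum, integral_add j1 j2, integral_const_mul, integral_const_mul, integral_const_mul,
      integral_const_mul, ← hMdef] at hint
    nlinarith
  rw [integral_add (ipow 2 two_ne_zero) (ipow 4 (by norm_num))]
  linarith

/-! ### The nonlinearity and its Pohozaev density -/

/-- In this form continuity is visible: the base `max |s| 1` stays away from 0, and `min |s| 1` has
a positive exponent when `p > 1`. -/
lemma subcriticalTerm_eq (p q s : ℝ) :
    subcriticalTerm p q s = max |s| 1 ^ (q - 1) * min |s| 1 ^ (p - 1) * s := by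
  unfold subcriticalTerm
  split_ifs with h
  · rw [max_eq_right h.le, min_eq_left h.le, Real.one_rpow, one_mul]
  · rw [max_eq_left (not_lt.1 h), min_eq_right (not_lt.1 h), Real.one_rpow, mul_one]

lemma continuous_subcriticalTerm {p : ℝ} (hp : 1 < p) (q : ℝ) :
    Continuous (subcriticalTerm p q) := by
  rw [show subcriticalTerm p q = fun s => max |s| 1 ^ (q - 1) * min |s| 1 ^ (p - 1) * s from
    funext fun s => subcriticalTerm_eq p q s]
  refine (Continuous.mul ?_ ?_).mul continuous_id
  · exact (continuous_abs.max continuous_const).rpow_const fun s =>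
      Or.inl (zero_lt_one.trans_le (le_max_right _ _)).ne'
  · exact (continuous_abs.min continuous_const).rpow_const fun s => Or.inr (by linarith)

lemma subcriticalTerm_zero (p q : ℝ) : subcriticalTerm p q 0 = 0 := by
  simp [subcriticalTerm]

lemma subcriticalTerm_nonneg (p q : ℝ) {s : ℝ} (hs : 0 ≤ s) : 0 ≤ subcriticalTerm p q s := by
  rw [subcriticalTerm_eq]
  positivity

lemma subcriticalTerm_of_le_one (p q : ℝ) {s : ℝ} (hs : 0 < s) (hs1 : s ≤ 1) :
    subcriticalTerm p q s = s ^ p := by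
  rw [subcriticalTerm_eq, abs_of_pos hs, max_eq_right hs1, min_eq_left hs1, Real.one_rpow, one_mul,
    ← Real.rpow_add_one hs.ne', sub_add_cancel]

lemma subcriticalTerm_of_one_le (p q : ℝ) {s : ℝ} (hs : 1 ≤ s) :
    subcriticalTerm p q s = s ^ q := by
  have hs0 : 0 < s := by linarith
  rw [subcriticalTerm_eq, abs_of_pos hs0, max_eq_left hs, min_eq_right hs, Real.one_rpow, mul_one,
    ← Real.rpow_add_one hs0.ne', sub_add_cancel]

lemma subcriticalTerm_le {p q : ℝ} (hp : 1 < p) (hq3 : q ≤ 3) {s : ℝ} (hs : 0 ≤ s) :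
    subcriticalTerm p q s ≤ s + s ^ 3 := by
  rcases hs.eq_or_lt with rfl | hs
  · simp [subcriticalTerm_zero]
  rcases le_total s 1 with h | h
  · rw [subcriticalTerm_of_le_one p q hs h]
    have := Real.rpow_le_rpow_of_exponent_ge hs h hp.le
    rw [Real.rpow_one] at this
    linarith [pow_pos hs 3]
  · rw [subcriticalTerm_of_one_le p q h]
    have := Real.rpow_le_rpow_of_exponent_le h hq3
    rw [show (3 : ℝ) = (3 : ℕ) by norm_num, Real.rpow_natCast] at this
    linarith

lemma subcriticalTerm_le_pow_five {p q : ℝ} (hp : 5 ≤ p) (hq3 : q ≤ 3) {s : ℝ} (hs : 0 ≤ s) :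
    subcriticalTerm p q s ≤ s ^ 5 := by
  rcases hs.eq_or_lt with rfl | hs
  · simp [subcriticalTerm_zero]
  rw [← Real.rpow_natCast]
  rcases le_total s 1 with h | h
  · rw [subcriticalTerm_of_le_one p q hs h]
    exact Real.rpow_le_rpow_of_exponent_ge hs h (by exact_mod_cast hp)
  · rw [subcriticalTerm_of_one_le p q h]
    exact Real.rpow_le_rpow_of_exponent_le h (by norm_num; linarith)

/-- The quotient of the subcritical term by the critical power. -/
noncomputable def criticalQuotient (p q s : ℝ) : ℝ := max s 1 ^ (q - 5) * min s 1 ^ (p - 5)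

lemma subcriticalTerm_eq_mul (p q : ℝ) {s : ℝ} (hs : 0 ≤ s) :
    subcriticalTerm p q s = criticalQuotient p q s * s ^ 5 := by
  rcases hs.eq_or_lt with rfl | hs
  · simp [subcriticalTerm_zero]
  unfold criticalQuotient
  rcases le_total s 1 with h | h
  · rw [subcriticalTerm_of_le_one p q hs h, max_eq_right h, min_eq_left h, Real.one_rpow, one_mul,
      ← Real.rpow_natCast, ← Real.rpow_add hs]
    norm_num
  · rw [subcriticalTerm_of_one_le p q h, max_eq_left h, min_eq_right h, Real.one_rpow, mul_one,
      ← Real.rpow_natCast, ← Real.rpow_add hs]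
    norm_num

lemma criticalQuotient_anti {p q : ℝ} (hp5 : p ≤ 5) (hq3 : q ≤ 3) {σ s : ℝ} (hσ : 0 < σ)
    (hσs : σ ≤ s) : criticalQuotient p q s ≤ criticalQuotient p q σ := by
  unfold criticalQuotient
  have h1 : max s 1 ^ (q - 5) ≤ max σ 1 ^ (q - 5) :=
    Real.rpow_le_rpow_of_nonpos (zero_lt_one.trans_le (le_max_right _ _))
      (max_le_max hσs le_rfl) (by linarith)
  have h2 : min s 1 ^ (p - 5) ≤ min σ 1 ^ (p - 5) :=
    Real.rpow_le_rpow_of_nonpos (lt_min hσ one_pos) (min_le_min hσs le_rfl) (by linarith)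
  have h3 : 0 ≤ min s 1 := le_min (hσ.le.trans hσs) zero_le_one
  have h4 : 0 ≤ max σ 1 := zero_le_one.trans (le_max_right _ _)
  exact mul_le_mul h1 h2 (Real.rpow_nonneg h3 _) (Real.rpow_nonneg h4 _)

/-- A strict drop of the quotient makes the density strictly positive. For `p = 5` the quotient is
constantly 1 on `(0, 1]`, so `s ≤ 1` has to be excluded there. -/
lemma exists_criticalQuotient_lt {p q : ℝ} (hq3 : q ≤ 3) {s : ℝ} (hs : 0 < s)
    (h : p < 5 ∨ 1 < s) :
    ∃ σ ∈ Ioc 0 s, criticalQuotient p q s < criticalQuotient p q σ := by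
  unfold criticalQuotient
  by_cases hs1 : 1 < s
  · refine ⟨1, ⟨one_pos, hs1.le⟩, ?_⟩
    rw [max_eq_left hs1.le, min_eq_right hs1.le, max_self, min_self, Real.one_rpow, Real.one_rpow,
      mul_one, one_mul]
    exact Real.rpow_lt_one_of_one_lt_of_neg hs1 (by linarith)
  · have hp5 : p < 5 := h.resolve_right hs1
    have hs1' := not_lt.1 hs1
    refine ⟨s / 2, ⟨by positivity, by linarith⟩, ?_⟩
    rw [max_eq_right hs1', min_eq_left hs1', max_eq_right (by linarith), min_eq_left (by linarith),
      Real.one_rpow, one_mul, one_mul]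
    exact Real.rpow_lt_rpow_of_neg (by positivity) (by linarith) (by linarith)

/-- The primitive of the subcritical term vanishing at `0`. -/
noncomputable def subcriticalPrimitive (p q s : ℝ) : ℝ :=
  ∫ σ in (0 : ℝ)..s, subcriticalTerm p q σ

lemma hasDerivAt_subcriticalPrimitive {p : ℝ} (hp : 1 < p) (q s : ℝ) :
    HasDerivAt (subcriticalPrimitive p q) (subcriticalTerm p q s) s :=
  intervalIntegral.integral_hasDerivAt_right
    ((continuous_subcriticalTerm hp q).intervalIntegrable _ _)
    ((continuous_subcriticalTerm hp q).stronglyMeasurableAtFilter _ _)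
    (continuous_subcriticalTerm hp q).continuousAt

lemma subcriticalPrimitive_zero (p q : ℝ) : subcriticalPrimitive p q 0 = 0 :=
  intervalIntegral.integral_same

/-- The integrand of Pohozaev's identity. -/
noncomputable def pohozaevDensity (p q s : ℝ) : ℝ :=
  6 * subcriticalPrimitive p q s - s * subcriticalTerm p q s

lemma continuous_pohozaevDensity {p : ℝ} (hp : 1 < p) (q : ℝ) :
    Continuous (pohozaevDensity p q) := by
  have h1 := continuous_subcriticalTerm hp q
  have h2 : Continuous (subcriticalPrimitive p q) :=
    continuous_iff_continuousAt.2 fun s => (hasDerivAt_subcriticalPrimitive hp q s).continuousAt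
  unfold pohozaevDensity
  fun_prop

lemma pohozaevDensity_zero (p q : ℝ) : pohozaevDensity p q 0 = 0 := by
  simp [pohozaevDensity, subcriticalPrimitive_zero]

lemma abs_pohozaevDensity_le {p q : ℝ} (hp : 1 < p) (hq3 : q ≤ 3) {s : ℝ} (hs : 0 ≤ s) :
    |pohozaevDensity p q s| ≤ 4 * (s ^ 2 + s ^ 4) := by
  have hc := continuous_subcriticalTerm hp q
  have hc2 : Continuous fun σ : ℝ => σ + σ ^ 3 := by fun_prop
  have h1 : subcriticalPrimitive p q s ≤ ∫ σ in (0 : ℝ)..s, (σ + σ ^ 3) :=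
    intervalIntegral.integral_mono_on hs (hc.intervalIntegrable _ _) (hc2.intervalIntegrable _ _)
      fun σ hσ => subcriticalTerm_le hp hq3 hσ.1
  have h2 : 0 ≤ subcriticalPrimitive p q s :=
    intervalIntegral.integral_nonneg hs fun σ hσ => subcriticalTerm_nonneg p q hσ.1
  have h3 : ∫ σ in (0 : ℝ)..s, (σ + σ ^ 3) = s ^ 2 / 2 + s ^ 4 / 4 := by
    rw [intervalIntegral.integral_add (continuous_id'.intervalIntegrable _ _)
      ((continuous_pow 3).intervalIntegrable _ _), integral_id, integral_pow]
    norm_num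
  have h4 : s * subcriticalTerm p q s ≤ s ^ 2 + s ^ 4 := by
    have := mul_le_mul_of_nonneg_left (subcriticalTerm_le hp hq3 hs) hs
    linarith
  have h5 : 0 ≤ s * subcriticalTerm p q s := mul_nonneg hs (subcriticalTerm_nonneg p q hs)
  rw [h3] at h1
  have h6 := sq_nonneg s
  have h7 := pow_nonneg hs 4
  unfold pohozaevDensity
  rw [abs_le]
  constructor <;> linarith

lemma integral_mul_pow_five (a s : ℝ) : ∫ σ in (0 : ℝ)..s, a * σ ^ 5 = a * s ^ 6 / 6 := by
  rw [intervalIntegral.integral_const_mul, integral_pow]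
  norm_num
  ring

/-- Since `g(σ)/σ⁵` is nonincreasing, `6G(s)` is at least `6 (g(s)/s⁵) ∫₀ˢ σ⁵ dσ = s g(s)`. -/
lemma pohozaevDensity_nonneg {p q : ℝ} (hp : 1 < p) (hp5 : p ≤ 5) (hq3 : q ≤ 3) {s : ℝ}
    (hs : 0 ≤ s) : 0 ≤ pohozaevDensity p q s := by
  have hc := continuous_subcriticalTerm hp q
  have hc2 : Continuous fun σ : ℝ => criticalQuotient p q s * σ ^ 5 := by fun_prop
  have h1 : ∫ σ in (0 : ℝ)..s, criticalQuotient p q s * σ ^ 5 ≤ subcriticalPrimitive p q s :=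
    intervalIntegral.integral_mono_on hs (hc2.intervalIntegrable _ _) (hc.intervalIntegrable _ _)
      fun σ hσ => by
        rw [subcriticalTerm_eq_mul p q hσ.1]
        rcases hσ.1.eq_or_lt with rfl | h0
        · simp
        · exact mul_le_mul_of_nonneg_right (criticalQuotient_anti hp5 hq3 h0 hσ.2)
            (pow_nonneg hσ.1 5)
  rw [integral_mul_pow_five] at h1
  unfold pohozaevDensity
  rw [subcriticalTerm_eq_mul p q hs]
  linarith

lemma pohozaevDensity_pos {p q : ℝ} (hp : 1 < p) (hp5 : p ≤ 5) (hq3 : q ≤ 3) {s : ℝ}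
    (hs : 0 < s) (h : p < 5 ∨ 1 < s) : 0 < pohozaevDensity p q s := by
  have hc := continuous_subcriticalTerm hp q
  have hc2 : Continuous fun σ : ℝ => criticalQuotient p q s * σ ^ 5 := by fun_prop
  obtain ⟨τ, hτ, hlt⟩ := exists_criticalQuotient_lt (p := p) hq3 hs h
  have h1 : ∫ σ in (0 : ℝ)..s, criticalQuotient p q s * σ ^ 5 < subcriticalPrimitive p q s :=
    intervalIntegral.integral_lt_integral_of_continuousOn_of_le_of_exists_lt hs hc2.continuousOn
      hc.continuousOn
      (fun σ hσ => by
        rw [subcriticalTerm_eq_mul p q hσ.1.le]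
        exact mul_le_mul_of_nonneg_right (criticalQuotient_anti hp5 hq3 hσ.1 hσ.2)
          (pow_nonneg hσ.1.le 5))
      ⟨τ, ⟨hτ.1.le, hτ.2⟩, by
        rw [subcriticalTerm_eq_mul p q hτ.1.le]
        exact mul_lt_mul_of_pos_right hlt (pow_pos hτ.1 5)⟩
  rw [integral_mul_pow_five] at h1
  unfold pohozaevDensity
  rw [subcriticalTerm_eq_mul p q hs.le]
  linarith

/-! ### Lower bounds for the parameter -/

/-- The right-hand side of the equation as a function of the unknown. -/
noncomputable def reaction (p q lam s : ℝ) : ℝ := lam * subcriticalTerm p q s + |s| ^ 4 * s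

lemma continuous_reaction {p : ℝ} (hp : 1 < p) (q lam : ℝ) : Continuous (reaction p q lam) := by
  have := continuous_subcriticalTerm hp q
  unfold reaction
  fun_prop

lemma reaction_eq (p q lam : ℝ) {s : ℝ} : reaction p q lam s = lam * subcriticalTerm p q s + s ^ 5 := by
  rw [reaction, Even.pow_abs (by decide)]
  ring

lemma IsPositiveSolution.isDirichletSolution {Ω : Set E3} (hΩ : IsBoundedC1Domain Ω)
    {p q lam : ℝ} (hp : 1 < p) {u : E3 → ℝ} (hu : IsPositiveSolution Ω p q lam u) :
    IsDirichletSolution Ω (fun x => reaction p q lam (Ω.indicator u x)) (Ω.indicator u) := by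
  have hev : ∀ x ∈ Ω, Ω.indicator u =ᶠ[𝓝 x] u := fun x hx => by
    filter_upwards [hΩ.isOpen.mem_nhds hx] with y hy using indicator_of_mem hy u
  have hcont : Continuous (Ω.indicator u) := continuous_indicator hu.boundary hu.continuousOn
  exact
    { isOpen := hΩ.isOpen
      isBounded := hΩ.isBounded
      contDiffOn := hu.contDiffOn.congr fun x hx => indicator_of_mem hx u
      continuous := hcont
      equation := fun x hx => by
        rw [(InnerProductSpace.laplacian_congr_nhds (hev x hx)).self_of_nhds, hu.equation x hx,
          indicator_of_mem hx]
        rfl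
      pos := fun x hx => by
        rw [indicator_of_mem hx]
        exact hu.pos x hx
      eq_zero := fun x hx => indicator_of_notMem hx u
      continuous_rhs := (continuous_reaction hp q lam).comp hcont
      rhs_eq_zero := fun x hx => by
        simp [indicator_of_notMem hx, reaction, subcriticalTerm_zero] }

namespace IsDirichletSolution

variable {Ω : Set E3} {p q lam c : ℝ} {v : E3 → ℝ}

/-- The critical power drops out, since `6 · s⁶/6 - s · s⁵ = 0`. -/
lemma pohozaev_reaction (S : IsDirichletSolution Ω (fun x => reaction p q lam (v x)) v)
    (hp : 1 < p) (h0Ω : (0 : E3) ∈ Ω) (hc : 0 < c) (hstar : IsQuantStarshaped Ω c) :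
    c ^ 2 / (27 * volume.real Ω) * (∫ x, reaction p q lam (v x)) ^ 2 ≤
      lam * ∫ x, pohozaevDensity p q (v x) := by
  have hF : ∀ s, HasDerivAt (fun s => lam * subcriticalPrimitive p q s + s ^ 6 / 6)
      (reaction p q lam s) s := fun s => by
    refine (((hasDerivAt_subcriticalPrimitive hp q s).const_mul lam).add
      ((hasDerivAt_pow 6 s).div_const 6)).congr_deriv ?_
    rw [reaction_eq]
    norm_num
  have hpo := S.pohozaev h0Ω hc hstar (continuous_reaction hp q lam) hF
    (by simp [subcriticalPrimitive_zero])
  have hFc : Continuous fun s => lam * subcriticalPrimitive p q s + s ^ 6 / 6 :=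
    continuous_iff_continuousAt.2 fun s => (hF s).continuousAt
  have hFi : Integrable fun x => lam * subcriticalPrimitive p q (v x) + v x ^ 6 / 6 :=
    (hFc.comp S.continuous).integrable_of_hasCompactSupport
      (HasCompactSupport.intro S.hasCompactSupport fun x hx => by
        simp [image_eq_zero_of_notMem_tsupport hx, subcriticalPrimitive_zero])
  refine hpo.trans_eq ?_
  rw [← integral_const_mul, ← integral_const_mul,
    ← integral_sub (hFi.const_mul 6) (S.integrable_rhs_mul S.continuous)]
  refine integral_congr_ae (Eventually.of_forall fun x => ?_)
  simp only [pohozaevDensity]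
  rw [reaction_eq]
  ring

lemma hasCompactSupport_pohozaevDensity
    (S : IsDirichletSolution Ω (fun x => reaction p q lam (v x)) v) :
    HasCompactSupport fun x => pohozaevDensity p q (v x) :=
  HasCompactSupport.intro S.hasCompactSupport fun x hx => by
    rw [image_eq_zero_of_notMem_tsupport hx, pohozaevDensity_zero]

/-- There is no solution with negative parameter if `p ≤ 5`. -/
lemma parameter_nonneg (S : IsDirichletSolution Ω (fun x => reaction p q lam (v x)) v)
    (hp : 1 < p) (hp5 : p ≤ 5) (hq3 : q ≤ 3) (h0Ω : (0 : E3) ∈ Ω) (hc : 0 < c)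
    (hstar : IsQuantStarshaped Ω c) : 0 ≤ lam := by
  by_contra hlam
  have hlam' : lam < 0 := not_le.1 hlam
  have hvol : 0 < volume.real Ω :=
    ENNReal.toReal_pos (S.isOpen.measure_pos volume ⟨0, h0Ω⟩).ne' S.isBounded.measure_lt_top.ne
  have hpo := S.pohozaev_reaction hp h0Ω hc hstar
  have hHc : Continuous fun x => pohozaevDensity p q (v x) :=
    (continuous_pohozaevDensity hp q).comp S.continuous
  have hH0 : ∀ x, 0 ≤ pohozaevDensity p q (v x) := fun x =>
    pohozaevDensity_nonneg hp hp5 hq3 (S.nonneg x)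
  have hHint : 0 ≤ ∫ x, pohozaevDensity p q (v x) := integral_nonneg hH0
  have hκ : 0 < c ^ 2 / (27 * volume.real Ω) := by positivity
  have hprod : lam * ∫ x, pohozaevDensity p q (v x) ≤ 0 :=
    mul_nonpos_of_nonpos_of_nonneg hlam'.le hHint
  -- Both sides of Pohozaev's inequality have opposite signs, so both vanish.
  have hM : ∫ x, reaction p q lam (v x) = 0 := by
    have h1 := hpo.trans hprod
    have h2 := nonpos_of_mul_nonpos_right h1 hκ
    exact pow_eq_zero_iff two_ne_zero |>.1 (le_antisymm h2 (sq_nonneg _))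
  have hHint0 : ¬ 0 < ∫ x, pohozaevDensity p q (v x) := fun h => by
    have h1 : 0 ≤ c ^ 2 / (27 * volume.real Ω) * (∫ x, reaction p q lam (v x)) ^ 2 := by positivity
    linarith [mul_neg_of_neg_of_pos hlam' h]
  have hHz : ∀ x, pohozaevDensity p q (v x) = 0 := fun x => by
    by_contra hne
    exact hHint0 (hHc.integral_pos_of_hasCompactSupport_nonneg_nonzero
      S.hasCompactSupport_pohozaevDensity hH0 hne)
  -- The density vanishes along `v`, which leaves only `p = 5` with `v ≤ 1`, where the reaction is a
  -- pure fifth power.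
  have hcrit : ∀ x ∈ Ω, ¬ (p < 5 ∨ 1 < v x) := fun x hx h =>
    (pohozaevDensity_pos hp hp5 hq3 (S.pos x hx) h).ne' (hHz x)
  have hp5' : p = 5 := le_antisymm hp5 (not_lt.1 fun h => hcrit 0 h0Ω (Or.inl h))
  have hreact : ∀ x, reaction p q lam (v x) = (1 + lam) * v x ^ 5 := fun x => by
    by_cases hx : x ∈ Ω
    · rw [reaction_eq, subcriticalTerm_of_le_one p q (S.pos x hx)
        (not_lt.1 fun h => hcrit x hx (Or.inr h)), hp5', show (5 : ℝ) = (5 : ℕ) by norm_num,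
        Real.rpow_natCast]
      ring
    · rw [reaction_eq, S.eq_zero x hx, subcriticalTerm_zero]
      ring
  have hv5 : 0 < ∫ x, v x ^ 5 := by
    have h5 : Continuous fun x => v x ^ 5 := S.continuous.pow 5
    exact h5.integral_pos_of_hasCompactSupport_nonneg_nonzero (x := 0)
      (S.hasCompactSupport.fun_pow (by norm_num)) (fun x => pow_nonneg (S.nonneg x) 5)
      (pow_pos (S.pos 0 h0Ω) 5).ne'
  -- The remaining case has zero right-hand side, which `integral_rhs_pos` rules out.
  have hlam1 : 1 + lam = 0 := by
    simp_rw [hreact] at hM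
    rw [integral_const_mul] at hM
    exact (mul_eq_zero.1 hM).resolve_right hv5.ne'
  have := S.integral_rhs_pos h0Ω fun x => by rw [hreact, hlam1, zero_mul]
  exact this.ne' hM

/-- Both sides of Pohozaev's inequality are now of order `M²`, and `M > 0` can be cancelled. Writing
`C + 1` for `C` keeps the denominator positive. -/
lemma parameter_bound (S : IsDirichletSolution Ω (fun x => reaction p q lam (v x)) v)
    (hp : 1 < p) (hq3 : q ≤ 3) (h0Ω : (0 : E3) ∈ Ω) (hc : 0 < c) (hstar : IsQuantStarshaped Ω c)
    (hv5 : ∀ x, v x ^ 5 ≤ 2 * reaction p q lam (v x)) {C : ℝ} (hC0 : 0 ≤ C)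
    (hC : ∫ x, (v x ^ 2 + v x ^ 4) ≤ C * (∫ x, reaction p q lam (v x)) ^ 2) :
    c ^ 2 / (27 * volume.real Ω) / (4 * (C + 1)) ≤ |lam| := by
  have hM := S.integral_rhs_pos h0Ω fun x => by
    have := pow_nonneg (S.nonneg x) 5
    linarith [hv5 x]
  have hpo := S.pohozaev_reaction hp h0Ω hc hstar
  set M := ∫ x, reaction p q lam (v x)
  have hHc : Continuous fun x => pohozaevDensity p q (v x) :=
    (continuous_pohozaevDensity hp q).comp S.continuous
  have i1 : Integrable fun x => 4 * (v x ^ 2 + v x ^ 4) :=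
    ((integrable_pow_of_hasCompactSupport S.continuous S.hasCompactSupport two_ne_zero).add
      (integrable_pow_of_hasCompactSupport S.continuous S.hasCompactSupport
        four_ne_zero)).const_mul 4
  have hHle : |∫ x, pohozaevDensity p q (v x)| ≤ 4 * (C * M ^ 2) := by
    rw [← Real.norm_eq_abs]
    refine (norm_integral_le_of_norm_le i1 (Eventually.of_forall fun x => ?_)).trans ?_
    · exact abs_pohozaevDensity_le hp hq3 (S.nonneg x)
    · rw [integral_const_mul]
      gcongr
  have h1 : lam * ∫ x, pohozaevDensity p q (v x) ≤ |lam| * (4 * (C * M ^ 2)) := by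
    refine (le_abs_self _).trans ?_
    rw [abs_mul]
    gcongr
  rw [div_le_iff₀ (by positivity)]
  have hM2 : 0 < M ^ 2 := by positivity
  refine le_of_mul_le_mul_right ?_ hM2
  have h2 : 0 ≤ |lam| * M ^ 2 := by positivity
  nlinarith

end IsDirichletSolution

/-- A lower bound for the parameter that depends on the domain and the exponents only. -/
lemma exists_parameter_bound {Ω : Set E3} (hΩ : IsBoundedC1Domain Ω)
    (hstar : IsStrictlyStarshaped Ω) {p q : ℝ} (hp : 1 < p) (hq3 : q ≤ 3) :
    ∃ lam₀ : ℝ, 0 < lam₀ ∧ ∀ (lam : ℝ) (u : E3 → ℝ), IsPositiveSolution Ω p q lam u →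
      ((0 ≤ lam ∨ p ≤ 5) → lam₀ ≤ lam) ∧ lam₀ ≤ |lam| := by
  obtain ⟨hsc, c, hc, hnormal⟩ := hstar
  have h0Ω : (0 : E3) ∈ Ω := hsc.mem hΩ.isConnected.nonempty
  have hq := isQuantStarshaped_of_normal_bound hΩ hnormal
  have hvol : 0 < volume.real Ω :=
    ENNReal.toReal_pos (hΩ.isOpen.measure_pos volume ⟨0, h0Ω⟩).ne' hΩ.isBounded.measure_lt_top.ne
  obtain ⟨C, hC0, hC⟩ := exists_integral_sq_add_pow_four_le (volume.real Ω) hvol.le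
  -- The threshold `1/2` serves negative parameters: with `p ≥ 5` and `lam > -1/2`, the reaction is
  -- at least `v⁵ - v⁵/2`.
  refine ⟨min (1 / 2) (c ^ 2 / (27 * volume.real Ω) / (4 * (C + 1))),
    lt_min (by norm_num) (by positivity), fun lam u hu => ?_⟩
  have S := hu.isDirichletSolution hΩ hp
  have hbound (hv5 : ∀ x, Ω.indicator u x ^ 5 ≤ 2 * reaction p q lam (Ω.indicator u x)) :
      min (1 / 2) (c ^ 2 / (27 * volume.real Ω) / (4 * (C + 1))) ≤ |lam| :=
    (min_le_right _ _).trans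
      (S.parameter_bound hp hq3 h0Ω hc hq hv5 hC0 (hC Ω _ _ rfl h0Ω S hv5))
  have hnonneg (hlam : 0 ≤ lam) :
      min (1 / 2) (c ^ 2 / (27 * volume.real Ω) / (4 * (C + 1))) ≤ |lam| := by
    refine hbound fun x => ?_
    have h1 := mul_nonneg hlam (subcriticalTerm_nonneg p q (S.nonneg x))
    have h2 := pow_nonneg (S.nonneg x) 5
    rw [reaction_eq]
    linarith
  refine ⟨fun h => ?_, ?_⟩
  · have hlam : 0 ≤ lam := h.elim id fun hp5 => S.parameter_nonneg hp hp5 hq3 h0Ω hc hq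
    have := hnonneg hlam
    rwa [abs_of_nonneg hlam] at this
  · by_cases hlam : 0 ≤ lam
    · exact hnonneg hlam
    by_cases hhalf : 1 / 2 ≤ |lam|
    · exact (min_le_left _ _).trans hhalf
    refine hbound fun x => ?_
    have hp5 : 5 ≤ p := (not_le.1 fun hp5 =>
      hlam (S.parameter_nonneg hp hp5 hq3 h0Ω hc hq)).le
    have h1 := subcriticalTerm_le_pow_five hp5 hq3 (S.nonneg x)
    have h2 := subcriticalTerm_nonneg p q (S.nonneg x)
    have h3 : -(1 / 2) < lam := (abs_lt.1 (not_le.1 hhalf)).1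
    rw [reaction_eq]
    nlinarith

theorem theorem1 (Ω : Set E3) (hΩ : IsBoundedC1Domain Ω) (hstar : IsStrictlyStarshaped Ω)
    (p q : ℝ) (hp : 1 < p) (hq : 0 < q) (hq3 : q ≤ 3) :
    (∃ lam₀ : ℝ, 0 < lam₀ ∧ ∀ (lam : ℝ) (u : E3 → ℝ), IsPositiveSolution Ω p q lam u →
      ((0 ≤ lam ∨ p ≤ 5) → lam₀ ≤ lam) ∧ lam₀ ≤ |lam|) ∧
    ¬ BifurcatesFromInfinityAtZero Ω p q := by
  have hmain := exists_parameter_bound hΩ hstar hp hq3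
  refine ⟨hmain, ?_⟩
  obtain ⟨lam₀, hpos, hbound⟩ := hmain
  rintro ⟨lam, u, hsol, hlim, -⟩
  have hle := ge_of_tendsto' hlim.abs fun n => (hbound _ _ (hsol n)).2
  rw [abs_zero] at hle
  exact absurd hpos (not_lt.2 hle)
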